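/- **Proposition.** Let $n\ge 1$. For every $\epsilon\in(0,1)$ consider an $n\times n$ input-queued switch with queue lengths $$q_{ij}(t+1)=[q_{ij}(t)+a_{ij}(t)-s_{ij}(t)]^+,\qquad 1\le i,j\le n,\ t=0,1,2,\dots$$ The numbers of arrivals $a_{ij}(t)\in\{0,1,2,\dots\}$ are independent over all $(i,j,t)$, identically distributed in $t$ for each $(i,j)$, and almost surely bounded by a constant; $\mathbb P(a_{ij}(t)=0\ \forall i,j)>0$; and the traffic is uniform, $\mathbb E[a_{ij}(t)]=\frac{1-\epsilon}{n}$ for all $i,j$. All of these laws may depend on $\epsilon$. The scheduling is uniformly random: the schedules $\mathbf s(t)$ are i.i.d., uniformly distributed on the $n\times n$ permutation matrices, and independent of the arrivals. The initial queue lengths $\mathbf q(0)\in\{0,1,2,\dots\}^{n\times n}$ are independent of the arrivals and of the schedules. Then the following holds. 1. For every $\epsilon\in(0,1)$, $\mathbf q(t)$ is a time-homogeneous Markov chain with transition probabilities $\mathbb P([\mathbf x+\mathbf a(0)-\mathbf s(0)]^+=\mathbf y)$. On the set of states reachable from $\mathbf 0$, which is closed and which $\mathbf q(t)$ almost surely enters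 and never leaves again, this chain is irreducible, aperiodic and positive recurrent. 2. For every $\epsilon\in(0,1)$, $\mathbf q(t)$ converges in distribution as $t\to\infty$ to a random matrix $\bar{\mathbf q}$ with $\mathbb E[\sum_{ij}\bar q_{ij}]<\infty$. 3. If $\mathrm{Var}(a_{ij}(t))\to\tilde\sigma_{ij}^2$ as $\epsilon\downarrow0$ for all $i,j$, then, with $\|\tilde{\boldsymbol\sigma}\|^2=\sum_{ij}\tilde\sigma_{ij}^2$, $$\lim_{\epsilon\downarrow0}\epsilon\,\mathbb E\Big[\sum_{ij}\bar q_{ij}\Big]=\frac n2\|\tilde{\boldsymbol\sigma}\|^2+\frac{n(n-1)}2 .$$ If moreover $n\ge2$, random scheduling is not MaxWeight-like, that is, $\epsilon\,\mathbb E[\sum_{ij}\bar q_{ij}]$ does not converge to $\big(1-\frac1{2n}\big)\|\tilde{\boldsymbol\sigma}\|^2$ as $\epsilon\downarrow0$. 4. If the traffic is uniform Bernoulli, i.e. $a_{ij}(t)\in\{0,1\}$ almost surely for all $i,j,t,\epsilon$, then $$\lim_{\epsilon\downarrow0}\epsilon\,\mathbb E\Big[\sum_{ij}\bar q_{ij}\Big]=n(n-1).$$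 -/

import Mathlib

open MeasureTheory ProbabilityTheory Filter Topology
open scoped ENNReal

/-! ### Countable-state Markov chains -/

section MarkovChain

variable {S : Type*} [DecidableEq S]

/-- The `k`-step transition probabilities of the transition matrix `P`. -/
noncomputable def stepProb (P : S → S → ℝ≥0∞) : ℕ → S → S → ℝ≥0∞
  | 0, x, y => if x = y then 1 else 0
  | k + 1, x, y => ∑' z, P x z * stepProb P k z y

/-- `firstPassageProb P k x y` is the probability that the chain started at `x` visits `y` for the
first time after time `0` exactly at time `k`. -/
noncomputable def firstPassageProb (P : S → S → ℝ≥0∞) : ℕ → S → S → ℝ≥0∞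
  | 0, _, _ => 0
  | 1, x, y => P x y
  | k + 2, x, y => ∑' z, if z = y then 0 else P x z * firstPassageProb P (k + 1) z y

/-- The states that can be reached from `x` (in zero or more steps). -/
def reachableFrom (P : S → S → ℝ≥0∞) (x : S) : Set S :=
  {y | ∃ k, 0 < stepProb P k x y}

/-- The state `x` is positive recurrent: the chain started at `x` returns to `x` with
probability one, and the mean return time is finite. -/
def IsPositiveRecurrentState (P : S → S → ℝ≥0∞) (x : S) : Prop :=
  ∑' k, firstPassageProb P k x x = 1 ∧ ∑' k : ℕ, (k : ℝ≥0∞) * firstPassageProb P k x x < ∞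

/-- The state `x` is aperiodic: the only common divisor of the possible return times is `1`. -/
def IsAperiodicState (P : S → S → ℝ≥0∞) (x : S) : Prop :=
  ∀ d : ℕ, (∀ k, 1 ≤ k → 0 < stepProb P k x x → d ∣ k) → d = 1

/-- The set `C` of states is closed under the transitions of `P`, and the chain with transition
matrix `P` and state space `C` is irreducible, aperiodic and positive recurrent. -/
structure IsPositiveRecurrentOn (P : S → S → ℝ≥0∞) (C : Set S) : Prop where
  nonempty : C.Nonempty
  closed : ∀ x ∈ C, ∀ y, 0 < P x y → y ∈ C
  irreducible : ∀ x ∈ C, ∀ y ∈ C, y ∈ reachableFrom P x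
  aperiodic : ∀ x ∈ C, IsAperiodicState P x
  positiveRecurrent : ∀ x ∈ C, IsPositiveRecurrentState P x

/-- `X` is a time-homogeneous Markov chain with transition matrix `P`. -/
structure IsMarkovChain {Ω : Type*} [MeasurableSpace Ω] [MeasurableSpace S] (μ : Measure Ω)
    (X : ℕ → Ω → S) (P : S → S → ℝ≥0∞) : Prop where
  measurable : ∀ t, Measurable (X t)
  stochastic : ∀ x, ∑' y, P x y = 1
  markov : ∀ (t : ℕ) (x : ℕ → S),
    μ {ω | ∀ k ≤ t + 1, X k ω = x k} = μ {ω | ∀ k ≤ t, X k ω = x k} * P (x t) (x (t + 1))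

end MarkovChain

/-! ### The input-queued switch -/

/-- `n × n` matrices of natural numbers: queue lengths, arrivals and schedules. -/
abbrev SwitchMat (n : ℕ) : Type := Fin n → Fin n → ℕ

/-- The permutation matrix of `p`, as a schedule. -/
def permSchedule {n : ℕ} (p : Equiv.Perm (Fin n)) : SwitchMat n :=
  fun i j => if p i = j then 1 else 0

/-- The queue lengths `[q + a - s]⁺` after one time slot. Subtraction of natural numbers
is truncated at `0`, which is the positive part. -/
def queueStep {n : ℕ} (q a s : SwitchMat n) : SwitchMat n :=
  fun i j => (q i j + a i j) - s i j

/-- An `n × n` switch with arrivals `a`, schedules `s` and queue lengths `q`, under uniform traffic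
with heavy-traffic parameter `ε`, and under uniformly random scheduling. -/
structure IsRandomSwitch {n : ℕ} {Ω : Type*} [MeasurableSpace Ω] (μ : Measure Ω) (ε : ℝ)
    (a s q : ℕ → Ω → SwitchMat n) : Prop where
  measurable_arrival : ∀ t, Measurable (a t)
  measurable_schedule : ∀ t, Measurable (s t)
  measurable_init : Measurable (q 0)
  /-- The arrivals are independent over time slots and input-output pairs. -/
  indep_arrival : iIndepFun (fun (p : ℕ × Fin n × Fin n) ω => a p.1 ω p.2.1 p.2.2) μ
  /-- For each input-output pair, the arrivals are identically distributed over time. -/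
  ident_arrival : ∀ t i j, IdentDistrib (fun ω => a t ω i j) (fun ω => a 0 ω i j) μ μ
  /-- The arrivals are bounded. -/
  bounded_arrival : ∃ amax : ℕ, ∀ t i j, ∀ᵐ ω ∂μ, a t ω i j ≤ amax
  /-- With positive probability there are no arrivals in a time slot. -/
  no_arrival : ∀ t, 0 < μ {ω | a t ω = 0}
  /-- Uniform traffic: the mean arrival rate matrix is `((1 - ε) / n) • 𝟏`. -/
  mean_arrival : ∀ t i j, ∫ ω, (a t ω i j : ℝ) ∂μ = (1 - ε) / n
  /-- Each schedule is uniformly distributed on the `n!` permutation matrices. -/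
  uniform_schedule : ∀ t (p : Equiv.Perm (Fin n)),
    μ {ω | s t ω = permSchedule p} = ((n.factorial : ℕ) : ℝ≥0∞)⁻¹
  /-- Schedules are drawn afresh in each time slot. -/
  indep_schedule : iIndepFun s μ
  /-- Schedules are drawn independently of the arrivals. -/
  indep_arrival_schedule : IndepFun (fun ω t => a t ω) (fun ω t => s t ω) μ
  /-- The initial queue lengths are independent of all arrivals and schedules. -/
  indep_init : IndepFun (q 0) (fun ω => ((fun t => a t ω), (fun t => s t ω))) μ
  /-- The queue length dynamics. -/
  queue_succ : ∀ t ω, q (t + 1) ω = queueStep (q t ω) (a t ω) (s t ω)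

/-- One-step transition probabilities of the queue lengths: `x` moves to `[x + a - s]⁺`, where `a`
and `s` are the arrivals and the schedule of one time slot. -/
noncomputable def queueTransition {n : ℕ} {Ω : Type*} [MeasurableSpace Ω] (μ : Measure Ω)
    (a s : ℕ → Ω → SwitchMat n) (x y : SwitchMat n) : ℝ≥0∞ :=
  μ {ω | queueStep x (a 0 ω) (s 0 ω) = y}

/-- The sum of all queue lengths. -/
def totalQueue {n : ℕ} (x : SwitchMat n) : ℝ := ∑ i, ∑ j, (x i j : ℝ)

/-- The squared Frobenius norm. -/
def frobeniusSq {n : ℕ} (σ : Fin n → Fin n → ℝ) : ℝ := ∑ i, ∑ j, σ i j ^ 2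

/-- The heavy-traffic performance is MaxWeight-like: the mean total steady-state queue length `m ε`
satisfies `ε * m ε → (1 - 1 / (2 n)) ‖σ‖²` as `ε ↓ 0`. -/
def IsMaxWeightLike {n : ℕ} (m : ℝ → ℝ) (σ : Fin n → Fin n → ℝ) : Prop :=
  Tendsto (fun ε => ε * m ε) (𝓝[>] 0) (𝓝 ((1 - 1 / (2 * (n : ℝ))) * frobeniusSq σ))

/-! Under uniformly random scheduling each entry `(i, j)` is by itself a scalar Lindley queue. Its
net input `a - s` is i.i.d. in time, with drift `-ε / n` and second moment `c = Var a + (1/n)(1 -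
1/n) + (ε/n)²`. The dependence between entries of one schedule is irrelevant for the mean of the
sum.

Existence of the equilibrium is Loynes' argument. Applying the inputs in reversed order to the empty
state gives a backward iteration that has the same law as the forward one at each time
(`map_backwardOrbit_eq`) but is pathwise nondecreasing. Its means stay bounded, so it is almost
surely eventually constant. The limit `M` has an invariant law (`invariant_of_backwardOrbit`), and a
finite invariant measure forces positive recurrence by a Kac-type inequality. Any other initial
state is coupled to the empty one: by the strong law the negative drift eventually exhausts the
initial content (`queue_coupling`).

The mean comes from quadratic and linear drift (`tendsto_mean_queue`). With `δ = ε / n` and `u` the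
probability of an unused service, the first moment changes by `-δ + u` and the second by `-2δ m₁ + c
- u`. In the sum `u` cancels, and in the limit `2δ m₁ = c - δ`, provided that the second moments are
bounded, which the cubic drift gives. Summing over the `n²` queues yields an exact formula for every
`ε` (`exists_stationary`), and all heavy-traffic claims are its limits. -/

/-! ### Positive recurrence of countable chains from an invariant measure. -/

section MarkovChainTheory

variable {S : Type*} [DecidableEq S] {P : S → S → ℝ≥0∞}

/-- The probability that the chain started at `z` does not visit `x` at the times `1, …, k`. -/
noncomputable def avoidProb (P : S → S → ℝ≥0∞) (x : S) : ℕ → S → ℝ≥0∞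
  | 0, _ => 1
  | k + 1, z => ∑' w, if w = x then 0 else P z w * avoidProb P x k w

theorem tsum_eq_add_tsum_ite_zero (f : S → ℝ≥0∞) (x : S) :
    ∑' w, f w = f x + ∑' w, if w = x then 0 else f w := by
  rw [ENNReal.tsum_eq_add_tsum_ite x]
  congr!

theorem firstPassageProb_add_avoidProb (hP : ∀ x, ∑' y, P x y = 1) (x : S) (k : ℕ) (z : S) :
    firstPassageProb P (k + 1) z x + avoidProb P x (k + 1) z = avoidProb P x k z := by
  induction k generalizing z with
  | zero =>
    simp only [firstPassageProb, avoidProb, mul_one]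
    rw [← tsum_eq_add_tsum_ite_zero (fun w => P z w) x, hP]
  | succ k ih =>
    rw [firstPassageProb, avoidProb,
      show avoidProb P x (k + 1) z = ∑' w, if w = x then 0 else P z w * avoidProb P x k w from rfl,
      ← ENNReal.tsum_add]
    refine tsum_congr fun w => ?_
    by_cases h : w = x
    · simp [h]
    · simp [h, ← mul_add, ih]

/-- Under `π` the state at time 1 again has law `π`, so avoiding `x` at times `1, …, k + 1` amounts
to starting off `x` and avoiding it at times `1, …, k`. The missing term is the start at `x`. -/
theorem tsum_mul_avoidProb_succ {π : S → ℝ≥0∞} (hπ : ∀ y, ∑' x, π x * P x y = π y) (x : S)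
    (k : ℕ) :
    ∑' z, π z * avoidProb P x (k + 1) z + π x * avoidProb P x k x
      = ∑' z, π z * avoidProb P x k z := by
  have h : ∑' z, π z * avoidProb P x (k + 1) z
      = ∑' w, if w = x then 0 else π w * avoidProb P x k w := by
    simp only [avoidProb, ← ENNReal.tsum_mul_left]
    rw [ENNReal.tsum_comm]
    refine tsum_congr fun w => ?_
    by_cases h : w = x
    · simp [h]
    · simp only [h, if_false, ← mul_assoc]
      rw [ENNReal.tsum_mul_right, hπ]
  rw [h, add_comm, ← tsum_eq_add_tsum_ite_zero (fun w => π w * avoidProb P x k w) x]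

/-- Half of Kac's formula, by telescoping the preceding identity: the tail probabilities of the
return time sum to its mean. -/
theorem mul_tsum_avoidProb_le {π : S → ℝ≥0∞} (hπ : ∀ y, ∑' x, π x * P x y = π y) (x : S) :
    π x * ∑' k, avoidProb P x k x ≤ ∑' z, π z := by
  rw [← ENNReal.tsum_mul_left]
  refine ENNReal.tsum_le_of_sum_range_le fun N => ?_
  have : ∑ k ∈ Finset.range N, π x * avoidProb P x k x + ∑' z, π z * avoidProb P x N z
      = ∑' z, π z := by
    induction N with
    | zero => simp [avoidProb]
    | succ N ih =>
      rw [Finset.sum_range_succ, add_assoc, add_comm (π x * _), tsum_mul_avoidProb_succ hπ, ih]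
  exact this ▸ le_self_add

theorem sum_firstPassageProb_add_avoidProb (hP : ∀ x, ∑' y, P x y = 1) (x z : S) (N : ℕ) :
    ∑ k ∈ Finset.range (N + 1), firstPassageProb P k z x + avoidProb P x N z = 1 := by
  induction N with
  | zero => simp [firstPassageProb, avoidProb]
  | succ N ih => rw [Finset.sum_range_succ, add_assoc, firstPassageProb_add_avoidProb hP, ih]

/-- Summation by parts: the truncated mean of the passage time as a sum of its tails. -/
theorem sum_mul_firstPassageProb_add (hP : ∀ x, ∑' y, P x y = 1) (x z : S) (N : ℕ) :
    ∑ k ∈ Finset.range (N + 1), (k : ℝ≥0∞) * firstPassageProb P k z x + N * avoidProb P x N z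
      = ∑ k ∈ Finset.range N, avoidProb P x k z := by
  induction N with
  | zero => simp
  | succ N ih =>
    rw [Finset.sum_range_succ, add_assoc, ← mul_add, firstPassageProb_add_avoidProb hP,
      Finset.sum_range_succ (fun k => avoidProb P x k z) N, ← ih, Nat.cast_succ,
      add_mul, one_mul, add_assoc]

/-- A state charged by a finite invariant measure is positive recurrent. -/
theorem isPositiveRecurrentState_of_invariant (hP : ∀ x, ∑' y, P x y = 1) {π : S → ℝ≥0∞}
    (hπ : ∀ y, ∑' x, π x * P x y = π y) (hfin : ∑' z, π z ≠ ∞) {x : S} (hx : π x ≠ 0) :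
    IsPositiveRecurrentState P x := by
  have hsum : ∑' k, avoidProb P x k x ≠ ∞ := fun h => by
    have := mul_tsum_avoidProb_le hπ x
    rw [h, ENNReal.mul_top hx] at this
    exact hfin (top_le_iff.1 this)
  constructor
  · have h1 : Tendsto (fun N => ∑ k ∈ Finset.range (N + 1), firstPassageProb P k x x
        + avoidProb P x N x) atTop (𝓝 (∑' k, firstPassageProb P k x x + 0)) :=
      ((tendsto_add_atTop_iff_nat 1).2 ENNReal.summable.hasSum.tendsto_sum_nat).add
        (ENNReal.tendsto_atTop_zero_of_tsum_ne_top hsum)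
    simp only [sum_firstPassageProb_add_avoidProb hP, add_zero] at h1
    exact tendsto_nhds_unique h1 tendsto_const_nhds
  · refine lt_of_le_of_lt (ENNReal.tsum_le_of_sum_range_le fun N => ?_) hsum.lt_top
    calc _ ≤ ∑ k ∈ Finset.range (N + 1), (k : ℝ≥0∞) * firstPassageProb P k x x :=
          Finset.sum_le_sum_of_subset (Finset.range_mono (Nat.le_succ N))
      _ ≤ ∑ k ∈ Finset.range N, avoidProb P x k x :=
          sum_mul_firstPassageProb_add hP x x N ▸ le_self_add
      _ ≤ _ := ENNReal.sum_le_tsum _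

theorem stepProb_one (x y : S) : stepProb P 1 x y = P x y := by
  simp [stepProb]

/-- One term of the Chapman–Kolmogorov sum; only positivity is needed later, so the inequality
suffices. -/
theorem stepProb_mul_le (j k : ℕ) (x y z : S) :
    stepProb P j x y * stepProb P k y z ≤ stepProb P (j + k) x z := by
  induction j generalizing x with
  | zero =>
    by_cases h : x = y
    · simp [stepProb, h]
    · simp [stepProb, h]
  | succ j ih =>
    rw [Nat.succ_add, stepProb, stepProb, ← ENNReal.tsum_mul_right]
    refine ENNReal.tsum_le_tsum fun w => ?_
    rw [mul_assoc]
    gcongr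
    exact ih w

theorem stepProb_pos_add {j k : ℕ} {x y z : S} (h1 : 0 < stepProb P j x y)
    (h2 : 0 < stepProb P k y z) : 0 < stepProb P (j + k) x z :=
  (ENNReal.mul_pos h1.ne' h2.ne').trans_le (stepProb_mul_le j k x y z)

theorem reachableFrom_trans {x y z : S} (h1 : y ∈ reachableFrom P x)
    (h2 : z ∈ reachableFrom P y) : z ∈ reachableFrom P x := by
  obtain ⟨j, hj⟩ := h1
  obtain ⟨k, hk⟩ := h2
  exact ⟨j + k, stepProb_pos_add hj hk⟩

theorem mem_reachableFrom_self (x : S) : x ∈ reachableFrom P x := ⟨0, by simp [stepProb]⟩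

theorem mem_reachableFrom_of_pos {x y : S} (h : 0 < P x y) : y ∈ reachableFrom P x :=
  ⟨1, by rwa [stepProb_one]⟩

theorem stepProb_self_pos {o : S} (ho : 0 < P o o) (m : ℕ) : 0 < stepProb P m o o := by
  induction m with
  | zero => simp [stepProb]
  | succ m ih => exact stepProb_pos_add ih (by rwa [stepProb_one])

theorem tsum_mul_stepProb {π : S → ℝ≥0∞} (hπ : ∀ y, ∑' x, π x * P x y = π y) (k : ℕ) (y : S) :
    ∑' x, π x * stepProb P k x y = π y := by
  induction k with
  | zero => simp [stepProb]
  | succ k ih =>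
    simp only [stepProb, ← ENNReal.tsum_mul_left]
    rw [ENNReal.tsum_comm, ← ih]
    refine tsum_congr fun w => ?_
    simp only [← mul_assoc]
    rw [ENNReal.tsum_mul_right, hπ]

theorem invariant_ne_zero_of_reachable {π : S → ℝ≥0∞} (hπ : ∀ y, ∑' x, π x * P x y = π y)
    {x y : S} (hx : π x ≠ 0) (hy : y ∈ reachableFrom P x) : π y ≠ 0 := by
  obtain ⟨k, hk⟩ := hy
  rw [← tsum_mul_stepProb hπ k y]
  exact pos_iff_ne_zero.1 ((ENNReal.mul_pos hx hk.ne').trans_le (ENNReal.le_tsum x))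

/-- If the state `o` can be reached from every state, has a loop, and there is an invariant
probability, then the chain is positive recurrent on the class of `o`. -/
theorem isPositiveRecurrentOn_reachableFrom (hP : ∀ x, ∑' y, P x y = 1) {o : S}
    (ho : 0 < P o o) (hreach : ∀ x, o ∈ reachableFrom P x) {π : S → ℝ≥0∞}
    (hπ : ∀ y, ∑' x, π x * P x y = π y) (hsum : ∑' z, π z = 1) :
    IsPositiveRecurrentOn P (reachableFrom P o) where
  nonempty := ⟨o, mem_reachableFrom_self o⟩
  closed x hx y hxy := reachableFrom_trans hx (mem_reachableFrom_of_pos hxy)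
  irreducible x _ y hy := reachableFrom_trans (hreach x) hy
  aperiodic x hx d hd := by
    obtain ⟨j, hj⟩ := hreach x
    obtain ⟨k, hk⟩ := hx
    -- Waiting at the loop of `o` gives two consecutive return times, so a common divisor divides 1.
    have key (m : ℕ) : 0 < stepProb P (j + m + k) x x :=
      stepProb_pos_add (stepProb_pos_add hj (stepProb_self_pos ho m)) hk
    have h1 := hd _ (by omega) (key 1)
    have h2 := hd _ (by omega) (key 2)
    have : j + 2 + k = (j + 1 + k) + 1 := by omega
    rw [this] at h2
    exact Nat.dvd_one.1 ((Nat.dvd_add_right h1).1 h2)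
  positiveRecurrent x hx := by
    obtain ⟨z, hz⟩ : ∃ z, π z ≠ 0 := by
      by_contra! h
      simp [h] at hsum
    exact isPositiveRecurrentState_of_invariant hP hπ (by simp [hsum])
      (invariant_ne_zero_of_reachable hπ hz (reachableFrom_trans (hreach z) hx))

end MarkovChainTheory

/-! ### Independence of discrete variables and of disjoint blocks of an independent sequence. -/

section Independence

variable {Ω : Type*} [MeasurableSpace Ω] {μ : Measure Ω}

theorem generateFrom_range_singleton_eq {β : Type*} [mβ : MeasurableSpace β] [Countable β]
    [MeasurableSingletonClass β] :
    MeasurableSpace.generateFrom (Set.range (singleton : β → Set β)) = mβ := by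
  refine le_antisymm (MeasurableSpace.generateFrom_le ?_) fun s _ => ?_
  · rintro _ ⟨x, rfl⟩
    exact measurableSet_singleton x
  · rw [← Set.biUnion_of_singleton s]
    exact MeasurableSet.biUnion s.to_countable fun x _ =>
      MeasurableSpace.measurableSet_generateFrom ⟨x, rfl⟩

/-- Discrete random variables are independent if their joint point probabilities factorize. -/
theorem iIndepFun_of_singleton {ι β : Type*} [mβ : MeasurableSpace β] [Countable β]
    [MeasurableSingletonClass β] [Nonempty β] {X : ι → Ω → β} (hX : ∀ i, Measurable (X i))
    (h : ∀ (s : Finset ι) (x : ι → β),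
      μ (⋂ i ∈ s, X i ⁻¹' {x i}) = ∏ i ∈ s, μ (X i ⁻¹' {x i})) :
    iIndepFun X μ := by
  rw [iIndepFun_iff_iIndep]
  refine iIndepSets.iIndep (fun i => (hX i).comap_le)
    (fun i => Set.preimage (X i) '' Set.range (singleton : β → Set β))
    (fun i => ?_) (fun i => ?_) ?_
  · rintro _ ⟨_, ⟨x, rfl⟩, rfl⟩ _ ⟨_, ⟨y, rfl⟩, rfl⟩ ⟨ω, h1, h2⟩
    have hx : X i ω = x := h1
    have hy : X i ω = y := h2
    rw [← hx, ← hy, Set.inter_self]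
    exact ⟨_, ⟨_, rfl⟩, rfl⟩
  · rw [← MeasurableSpace.comap_generateFrom, generateFrom_range_singleton_eq]
  · rw [iIndepSets_iff]
    intro s f hf
    have : ∀ i, ∃ x, i ∈ s → f i = X i ⁻¹' {x} := fun i => by
      by_cases hi : i ∈ s
      · obtain ⟨_, ⟨x, rfl⟩, hx⟩ := hf i hi
        exact ⟨x, fun _ => hx.symm⟩
      · exact ⟨Classical.arbitrary β, fun h => absurd h hi⟩
    choose x hx using this
    rw [Set.iInter₂_congr hx, h s x]
    exact Finset.prod_congr rfl fun i hi => by rw [hx i hi]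

/-- If `f` is independent of `(g, h)`, and `g` of `h`, then `(f, g)` is independent of `h`. -/
theorem indepFun_prodMk_of_indepFun_prodMk [IsProbabilityMeasure μ] {α β γ : Type*}
    [MeasurableSpace α] [MeasurableSpace β] [MeasurableSpace γ] {f : Ω → α} {g : Ω → β}
    {h : Ω → γ} (hf : Measurable f) (hg : Measurable g) (hh : Measurable h)
    (hfgh : IndepFun f (fun ω => (g ω, h ω)) μ) (hgh : IndepFun g h μ) :
    IndepFun (fun ω => (f ω, g ω)) h μ := by
  have hfg : IndepFun f g μ := hfgh.comp (φ := id) (ψ := Prod.fst) measurable_id measurable_fst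
  have := Measure.isProbabilityMeasure_map (μ := μ) hf.aemeasurable
  have := Measure.isProbabilityMeasure_map (μ := μ) hg.aemeasurable
  have := Measure.isProbabilityMeasure_map (μ := μ) hh.aemeasurable
  rw [indepFun_iff_map_prod_eq_prod_map_map (by fun_prop) (by fun_prop)] at *
  rw [hfg, ← MeasurableEquiv.prodAssoc.map_measurableEquiv_injective.eq_iff,
    Measure.prodAssoc_prod, ← hgh, ← hfgh, Measure.map_map (by fun_prop) (by fun_prop)]
  rfl

variable {V : Type*} [MeasurableSpace V] {W : ℕ → Ω → V}

theorem measurable_biSup_comap {Ω V ι : Type*} [MeasurableSpace V] {X : ι → Ω → V}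
    {s : Set ι} {i : ι} (hi : i ∈ s) :
    Measurable[⨆ j ∈ s, MeasurableSpace.comap (X j) inferInstance] (X i) :=
  (comap_measurable (X i)).mono
    (le_iSup₂ (f := fun j (_ : j ∈ s) => MeasurableSpace.comap (X j) inferInstance) i hi) le_rfl

theorem indepFun_of_measurable_biSup {ι α β : Type*} [MeasurableSpace α] [MeasurableSpace β]
    {X : ι → Ω → V} (hX : ∀ i, Measurable (X i)) (h : iIndepFun X μ) {s t : Set ι}
    (hst : Disjoint s t) {f : Ω → α} {g : Ω → β}
    (hf : Measurable[⨆ j ∈ s, MeasurableSpace.comap (X j) inferInstance] f)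
    (hg : Measurable[⨆ j ∈ t, MeasurableSpace.comap (X j) inferInstance] g) :
    IndepFun f g μ := by
  rw [IndepFun_iff_Indep]
  exact indep_of_indep_of_le_left (indep_of_indep_of_le_right
    (indep_iSup_of_disjoint (fun i => (hX i).comap_le) ((iIndepFun_iff_iIndep _ _ _).1 h) hst)
    hg.comap_le) hf.comap_le

/-- Independent random variables: the past is independent of the present. -/
theorem indepFun_past [Inhabited V] (hW : ∀ t, Measurable (W t)) (h : iIndepFun W μ) (t : ℕ) :
    IndepFun (fun ω k => if k < t then W k ω else default) (W t) μ := by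
  refine indepFun_of_measurable_biSup hW h (s := Set.Iio t) (t := {t}) (by simp) ?_
    (measurable_biSup_comap rfl)
  refine @measurable_pi_lambda Ω ℕ (fun _ => V) (_) _ _ fun k => ?_
  by_cases hk : k < t
  · simp only [hk, if_true]
    exact measurable_biSup_comap (Set.mem_Iio.2 hk)
  · simp only [hk, if_false]
    exact @measurable_const _ _ _ (_) _

/-- Independent random variables: the future is independent of the present. -/
theorem indepFun_future (hW : ∀ t, Measurable (W t)) (h : iIndepFun W μ) (t : ℕ) :
    IndepFun (fun ω k => W (t + (k + 1)) ω) (W t) μ := by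
  refine indepFun_of_measurable_biSup hW h (s := Set.Ioi t) (t := {t}) (by simp) ?_
    (measurable_biSup_comap rfl)
  exact @measurable_pi_lambda Ω ℕ (fun _ => V) (_) _ _ fun k =>
    measurable_biSup_comap (i := t + (k + 1)) (by simp)

theorem indepFun_init_past [IsProbabilityMeasure μ] [Inhabited V] {β : Type*} [MeasurableSpace β]
    {f : Ω → β} (hW : ∀ t, Measurable (W t)) (hind : iIndepFun W μ)
    (hf : Measurable f) (hinit : IndepFun f (fun ω t => W t ω) μ) (t : ℕ) :
    IndepFun (fun ω => (f ω, fun k => if k < t then W k ω else default)) (W t) μ := by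
  have hm : Measurable fun (w : ℕ → V) k => if k < t then w k else default :=
    measurable_pi_lambda _ fun k => by
      by_cases hk : k < t
      · simpa only [hk, if_true] using measurable_pi_apply k
      · simp only [hk, if_false]
        exact measurable_const
  exact indepFun_prodMk_of_indepFun_prodMk hf (hm.comp (measurable_pi_lambda _ hW)) (hW t)
    (hinit.comp measurable_id (hm.prodMk (measurable_pi_apply t))) (indepFun_past hW hind t)

end Independence

/-! ### Recursions with i.i.d. inputs: Markov property and Loynes' backward iteration. -/

section DrivenRecursion

variable {S V : Type*}

/-- The forward iteration `x, F x w₀, F (F x w₀) w₁, …`. -/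
def drivenOrbit (F : S → V → S) (x : S) (w : ℕ → V) : ℕ → S
  | 0 => x
  | t + 1 => F (drivenOrbit F x w t) (w t)

/-- The backward (Loynes) iteration, in which `w₀` is applied last. -/
def backwardOrbit (F : S → V → S) (x : S) : ℕ → (ℕ → V) → S
  | 0, _ => x
  | t + 1, w => F (backwardOrbit F x t fun k => w (k + 1)) (w 0)

variable {F : S → V → S}

theorem drivenOrbit_congr (x : S) {w w' : ℕ → V} {t : ℕ} (h : ∀ k < t, w k = w' k) :
    drivenOrbit F x w t = drivenOrbit F x w' t := by
  induction t with
  | zero => rfl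
  | succ t ih =>
    rw [drivenOrbit, drivenOrbit, ih fun k hk => h k (by omega), h t (by omega)]

/-- One more backward step only replaces the innermost start `x` by some `F x v ≥ x`; the remaining
maps are monotone. -/
theorem backwardOrbit_le_succ [Preorder S] (hF : ∀ v, Monotone fun x => F x v) {x : S}
    (hx : ∀ y, x ≤ y) (t : ℕ) (w : ℕ → V) :
    backwardOrbit F x t w ≤ backwardOrbit F x (t + 1) w := by
  induction t generalizing w with
  | zero => exact hx _
  | succ t ih => exact hF _ (ih _)

theorem eq_drivenOrbit {Ω : Type*} {W : ℕ → Ω → V} {q : ℕ → Ω → S}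
    (hq : ∀ t ω, q (t + 1) ω = F (q t ω) (W t ω)) (t : ℕ) (ω : Ω) :
    q t ω = drivenOrbit F (q 0 ω) (fun k => W k ω) t := by
  induction t with
  | zero => rfl
  | succ t ih => rw [hq, ih, drivenOrbit]

/-- The state up to time `t` does not see the inputs from `t` on. Overwriting these by `default`
exhibits it as a function of data independent of `W t`. -/
theorem eq_drivenOrbit_past {Ω : Type*} [Inhabited V] {W : ℕ → Ω → V}
    {q : ℕ → Ω → S} (hq : ∀ t ω, q (t + 1) ω = F (q t ω) (W t ω)) {k t : ℕ} (hk : k ≤ t)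
    (ω : Ω) : q k ω = drivenOrbit F (q 0 ω) (fun j => if j < t then W j ω else default) k := by
  rw [eq_drivenOrbit hq]
  exact drivenOrbit_congr _ fun j hj => by simp [hj.trans_le hk]

variable [MeasurableSpace S] [Countable S] [MeasurableSingletonClass S]
  [MeasurableSpace V] [Countable V] [MeasurableSingletonClass V]

theorem measurable_drivenOrbit (F : S → V → S) (t : ℕ) :
    Measurable fun p : S × (ℕ → V) => drivenOrbit F p.1 p.2 t := by
  induction t with
  | zero => exact measurable_fst
  | succ t ih =>
    exact (Measurable.of_discrete (f := fun p : S × V => F p.1 p.2)).comp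
      (ih.prodMk ((measurable_pi_apply t).comp measurable_snd))

theorem measurable_backwardOrbit (F : S → V → S) (x : S) (t : ℕ) :
    Measurable (backwardOrbit F x t) := by
  induction t with
  | zero => exact measurable_const
  | succ t ih =>
    exact (Measurable.of_discrete (f := fun p : S × V => F p.1 p.2)).comp
      ((ih.comp (measurable_pi_lambda _ fun k => measurable_pi_apply (k + 1))).prodMk
        (measurable_pi_apply 0))

variable {Ω : Type*} [MeasurableSpace Ω] {W : ℕ → Ω → V} {q : ℕ → Ω → S}

theorem measurable_of_recursion (hW : ∀ t, Measurable (W t)) (hq0 : Measurable (q 0))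
    (hq : ∀ t ω, q (t + 1) ω = F (q t ω) (W t ω)) (t : ℕ) : Measurable (q t) := by
  have : q t = fun ω => drivenOrbit F (q 0 ω) (fun k => W k ω) t := funext (eq_drivenOrbit hq t)
  rw [this]
  exact (measurable_drivenOrbit F t).comp (hq0.prodMk (measurable_pi_lambda _ hW))

/-- The law of the next state depends only on the two marginal laws, which allows inductions on
laws. -/
theorem map_step_eq {μ : Measure Ω} [IsProbabilityMeasure μ] {f : Ω → S} {g : Ω → V}
    (hf : Measurable f) (hg : Measurable g)
    (h : IndepFun f g μ) :
    μ.map (fun ω => F (f ω) (g ω))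
      = ((μ.map f).prod (μ.map g)).map fun p : S × V => F p.1 p.2 := by
  rw [← h.map_prod_eq_prod_map_map hf.aemeasurable hg.aemeasurable,
    Measure.map_map Measurable.of_discrete (hf.prodMk hg)]
  rfl

theorem tsum_measure_mul_eq_lintegral (μ : Measure Ω) {f : Ω → S} (hf : Measurable f)
    (g : S → ℝ≥0∞) :
    ∑' x, μ {ω | f ω = x} * g x = ∫⁻ ω, g (f ω) ∂μ := by
  rw [← lintegral_map (f := g) Measurable.of_discrete hf, lintegral_countable']
  refine tsum_congr fun x => ?_
  rw [Measure.map_apply hf (measurableSet_singleton x), mul_comm]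
  rfl

variable [Inhabited V] {μ : Measure Ω} [IsProbabilityMeasure μ]

theorem indepFun_state_input (hW : ∀ t, Measurable (W t)) (hind : iIndepFun W μ)
    (hq0 : Measurable (q 0)) (hinit : IndepFun (q 0) (fun ω t => W t ω) μ)
    (hq : ∀ t ω, q (t + 1) ω = F (q t ω) (W t ω)) (t : ℕ) : IndepFun (q t) (W t) μ := by
  have := (indepFun_init_past hW hind hq0 hinit t).comp (measurable_drivenOrbit F t) measurable_id
  have h : q t = (fun p : S × (ℕ → V) => drivenOrbit F p.1 p.2 t) ∘
      fun ω => (q 0 ω, fun k => if k < t then W k ω else default) :=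
    funext (eq_drivenOrbit_past hq le_rfl)
  rw [h]
  exact this

/-- A recursion driven by i.i.d. inputs is a Markov chain. -/
theorem isMarkovChain_of_recursion [DecidableEq S] (hW : ∀ t, Measurable (W t))
    (hind : iIndepFun W μ) (hid : ∀ t, μ.map (W t) = μ.map (W 0)) (hq0 : Measurable (q 0))
    (hinit : IndepFun (q 0) (fun ω t => W t ω) μ)
    (hq : ∀ t ω, q (t + 1) ω = F (q t ω) (W t ω)) :
    IsMarkovChain μ q fun x y => μ {ω | F x (W 0 ω) = y} where
  measurable := measurable_of_recursion hW hq0 hq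
  stochastic x := by
    have hm : Measurable fun ω => F x (W 0 ω) := Measurable.of_discrete.comp (hW 0)
    have := Measure.isProbabilityMeasure_map (μ := μ) hm.aemeasurable
    rw [← measure_univ (μ := μ.map fun ω => F x (W 0 ω)),
      ← Measure.tsum_indicator_apply_singleton _ _ MeasurableSet.univ]
    refine tsum_congr fun y => ?_
    rw [Set.indicator_univ, Measure.map_apply hm (measurableSet_singleton y)]
    rfl
  markov t x := by
    have hind' := indepFun_init_past hW hind hq0 hinit t
    have hA : MeasurableSet {p : S × (ℕ → V) | ∀ k ≤ t, drivenOrbit F p.1 p.2 k = x k} := by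
      have : {p : S × (ℕ → V) | ∀ k ≤ t, drivenOrbit F p.1 p.2 k = x k}
          = ⋂ k ∈ Set.Iic t, (fun p => drivenOrbit F p.1 p.2 k) ⁻¹' {x k} := by
        ext p; simp
      rw [this]
      exact MeasurableSet.biInter (Set.to_countable _) fun k _ =>
        measurable_drivenOrbit F k (measurableSet_singleton _)
    have hB : MeasurableSet {v : V | F (x t) v = x (t + 1)} := MeasurableSet.of_discrete
    have h := hind'.measure_inter_preimage_eq_mul _ _ hA hB
    have e1 : (fun ω => (q 0 ω, fun k => if k < t then W k ω else default)) ⁻¹'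
        {p : S × (ℕ → V) | ∀ k ≤ t, drivenOrbit F p.1 p.2 k = x k}
        = {ω | ∀ k ≤ t, q k ω = x k} := by
      ext ω
      refine forall₂_congr fun k hk => ?_
      rw [eq_drivenOrbit_past hq hk]
    have e2 : μ (W t ⁻¹' {v : V | F (x t) v = x (t + 1)})
        = μ {ω | F (x t) (W 0 ω) = x (t + 1)} := by
      rw [← Measure.map_apply (hW t) hB, hid, Measure.map_apply (hW 0) hB]
      rfl
    rw [e1, e2] at h
    rw [← h]
    congr 1
    ext ω
    constructor
    · intro hω
      refine ⟨fun k hk => hω k (by omega), ?_⟩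
      have h1 := hω (t + 1) le_rfl
      rw [hq, hω t (by omega)] at h1
      exact h1
    · rintro ⟨h1, h2⟩ k hk
      rcases Nat.le_succ_iff.1 hk with hk | rfl
      · exact h1 k hk
      · rw [hq, h1 t le_rfl]
        exact h2

/-- The backward and the forward iteration have the same law at each time. -/
theorem map_backwardOrbit_eq (hW : ∀ t, Measurable (W t)) (hind : iIndepFun W μ)
    (hid : ∀ t, μ.map (W t) = μ.map (W 0)) (x : S) (t s : ℕ) :
    μ.map (fun ω => backwardOrbit F x t fun k => W (s + k) ω)
      = μ.map (fun ω => drivenOrbit F x (fun k => W k ω) t) := by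
  -- The shift `s` must vary because the backward recursion passes to the shifted inputs.
  induction t generalizing s with
  | zero => rfl
  | succ t ih =>
    have hsh (s : ℕ) : Measurable fun ω k => W (s + k) ω := measurable_pi_lambda _ fun k => hW _
    have h1 : IndepFun (fun ω => backwardOrbit F x t fun k => W (s + (k + 1)) ω) (W s) μ :=
      (indepFun_future hW hind s).comp (measurable_backwardOrbit F x t) measurable_id
    have e1 (ω : Ω) : backwardOrbit F x (t + 1) (fun k => W (s + k) ω)
        = F (backwardOrbit F x t fun k => W (s + (k + 1)) ω) (W s ω) := rfl
    have h2 : IndepFun (fun ω => drivenOrbit F x (fun k => W k ω) t) (W t) μ :=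
      indepFun_state_input (q := fun t ω => drivenOrbit F x (fun k => W k ω) t) hW hind
        measurable_const (indepFun_const_left x _) (fun _ _ => rfl) t
    have e2 : (fun ω => backwardOrbit F x t fun k => W (s + (k + 1)) ω)
        = fun ω => backwardOrbit F x t fun k => W (s + 1 + k) ω := by
      funext ω; congr 1; funext k; congr 1; omega
    simp only [e1, drivenOrbit]
    rw [map_step_eq (by rw [e2]; exact (measurable_backwardOrbit F x t).comp (hsh _)) (hW s) h1,
      map_step_eq (measurable_of_recursion (q := fun t ω => drivenOrbit F x (fun k => W k ω) t) hW
        measurable_const (fun _ _ => rfl) t) (hW t) h2, e2,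
      ih, hid s, hid t]

/-- The almost sure limit of the backward iteration has an invariant law. -/
theorem invariant_of_backwardOrbit (hW : ∀ t, Measurable (W t)) (hind : iIndepFun W μ)
    (hid : ∀ t, μ.map (W t) = μ.map (W 0)) (x₀ : S) {M : Ω → S} (hM : Measurable M)
    (hlim : ∀ᵐ ω ∂μ, ∀ᶠ t in atTop, backwardOrbit F x₀ t (fun k => W k ω) = M ω) (y : S) :
    ∑' x, μ {ω | M ω = x} * μ {ω | F x (W 0 ω) = y} = μ {ω | M ω = y} := by
  classical
  set P : S → S → ℝ≥0∞ := fun x y => μ {ω | F x (W 0 ω) = y}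
  set B : ℕ → Ω → S := fun t ω => backwardOrbit F x₀ t fun k => W k ω with hB
  have hBm (t : ℕ) : Measurable (B t) :=
    (measurable_backwardOrbit F x₀ t).comp (measurable_pi_lambda _ hW)
  -- Eventual constancy makes every bounded `g` pass to the limit; no continuity is involved.
  have hconv (g : S → ℝ≥0∞) (hg : ∀ x, g x ≤ 1) :
      Tendsto (fun t => ∫⁻ ω, g (B t ω) ∂μ) atTop (𝓝 (∫⁻ ω, g (M ω) ∂μ)) := by
    refine tendsto_lintegral_of_dominated_convergence (fun _ => 1)
      (fun t => Measurable.of_discrete.comp (hBm t)) (fun t => ae_of_all _ fun ω => hg _)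
      (by simp) ?_
    filter_upwards [hlim] with ω hω
    exact tendsto_const_nhds.congr' (hω.mono fun t ht => by simp only [hB, ht])
  -- Only laws enter, so the backward iterates may be exchanged for forward ones, whose state at
  -- time `t` is independent of the next input `W t`.
  have hstep (t : ℕ) : ∫⁻ ω, P (B t ω) y ∂μ = ∫⁻ ω, (if B (t + 1) ω = y then 1 else 0) ∂μ := by
    have hlaw (t : ℕ) : μ.map (B t) = μ.map (fun ω => drivenOrbit F x₀ (fun k => W k ω) t) := by
      simpa only [Nat.zero_add] using map_backwardOrbit_eq (F := F) hW hind hid x₀ t 0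
    have hDm (t : ℕ) : Measurable fun ω => drivenOrbit F x₀ (fun k => W k ω) t :=
      measurable_of_recursion (q := fun t ω => drivenOrbit F x₀ (fun k => W k ω) t) hW
        measurable_const (fun _ _ => rfl) t
    rw [← lintegral_map (f := fun x => P x y) Measurable.of_discrete (hBm t),
      ← lintegral_map (f := fun x => if x = y then (1 : ℝ≥0∞) else 0) Measurable.of_discrete
        (hBm (t + 1)), hlaw, hlaw]
    have h2 : IndepFun (fun ω => drivenOrbit F x₀ (fun k => W k ω) t) (W t) μ :=
      indepFun_state_input (q := fun t ω => drivenOrbit F x₀ (fun k => W k ω) t) hW hind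
        measurable_const (indepFun_const_left x₀ _) (fun _ _ => rfl) t
    simp only [drivenOrbit]
    have := Measure.isProbabilityMeasure_map (μ := μ) (hW 0).aemeasurable
    rw [map_step_eq (hDm t) (hW t) h2,
      lintegral_map (f := fun x => if x = y then (1 : ℝ≥0∞) else 0) Measurable.of_discrete
        Measurable.of_discrete,
      lintegral_prod _ Measurable.of_discrete.aemeasurable, hid t]
    refine lintegral_congr fun x => ?_
    have : (fun v => if F x v = y then (1 : ℝ≥0∞) else 0)
        = Set.indicator {v | F x v = y} 1 := by
      funext v; simp [Set.indicator_apply]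
    rw [this, lintegral_indicator_one MeasurableSet.of_discrete,
      Measure.map_apply (hW 0) MeasurableSet.of_discrete]
    rfl
  have h1 := hconv (fun x => P x y) fun x => prob_le_one
  have h2 := hconv (fun x => if x = y then 1 else 0) fun x => by split_ifs <;> simp
  simp only [hstep] at h1
  have h3 := tendsto_nhds_unique h1 ((tendsto_add_atTop_iff_nat 1).2 h2)
  rw [← tsum_measure_mul_eq_lintegral μ hM (fun x => P x y),
    ← tsum_measure_mul_eq_lintegral μ hM (fun x => if x = y then 1 else 0)] at h3
  simpa using h3

end DrivenRecursion

/-! ### Uniform permutation matrices. -/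

section Schedules

variable {n : ℕ}

theorem permSchedule_injective : Function.Injective (permSchedule (n := n)) := by
  intro p p' h
  ext i
  have := congrFun (congrFun h i) (p i)
  simp only [permSchedule, if_true] at this
  by_contra hne
  rw [if_neg fun h => hne (by rw [h])] at this
  exact one_ne_zero this

theorem permSchedule_le_one (p : Equiv.Perm (Fin n)) (i j : Fin n) : permSchedule p i j ≤ 1 := by
  unfold permSchedule
  split_ifs <;> simp

/-- Composition with a transposition shows that the sum is the same for every column; over all
columns each permutation contributes exactly 1. -/
theorem sum_permSchedule (i j : Fin n) :
    (n : ℝ) * ∑ p : Equiv.Perm (Fin n), (permSchedule p i j : ℝ) = n.factorial := by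
  have hj (j' : Fin n) : ∑ p : Equiv.Perm (Fin n), (permSchedule p i j' : ℝ)
      = ∑ p : Equiv.Perm (Fin n), (permSchedule p i j : ℝ) := by
    refine Fintype.sum_equiv (Equiv.mulLeft (Equiv.swap j' j)) _ _ fun p => ?_
    simp only [permSchedule, Equiv.coe_mulLeft, Equiv.Perm.coe_mul, Function.comp_apply]
    have : Equiv.swap j' j (p i) = j ↔ p i = j' := by
      rw [← Equiv.eq_symm_apply, Equiv.symm_swap, Equiv.swap_apply_right]
    simp only [this]
  have : ∑ j' : Fin n, ∑ p : Equiv.Perm (Fin n), (permSchedule p i j' : ℝ) = n.factorial := by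
    rw [Finset.sum_comm]
    simp [permSchedule, Fintype.card_perm]
  rw [← this, Finset.sum_congr rfl fun j' _ => hj j']
  simp

end Schedules

/-! ### Inputs of the switch are i.i.d.; access to the empty state. -/

namespace IsRandomSwitch

variable {n : ℕ} {Ω : Type*} [MeasurableSpace Ω] {μ : Measure Ω} {ε : ℝ}
  {a s q : ℕ → Ω → SwitchMat n}

theorem map_schedule [IsProbabilityMeasure μ] (h : IsRandomSwitch μ ε a s q) (t : ℕ) :
    μ.map (s t) = ∑ p : Equiv.Perm (Fin n),
      ((n.factorial : ℕ) : ℝ≥0∞)⁻¹ • Measure.dirac (permSchedule p) := by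
  have hs := h.measurable_schedule t
  have hfac : ((n.factorial : ℕ) : ℝ≥0∞) * ((n.factorial : ℕ) : ℝ≥0∞)⁻¹ = 1 :=
    ENNReal.mul_inv_cancel (by exact_mod_cast n.factorial_ne_zero) (ENNReal.natCast_ne_top _)
  -- The `n!` disjoint events exhaust the total mass, so all other matrices are null.
  have hrange : μ (⋃ p ∈ (Finset.univ : Finset (Equiv.Perm (Fin n))),
      {ω | s t ω = permSchedule p}) = 1 := by
    rw [measure_biUnion_finset]
    · simp [h.uniform_schedule, Fintype.card_perm, hfac]
    · intro p _ p' _ hne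
      refine Set.disjoint_left.2 fun ω h1 h2 => hne (permSchedule_injective ?_)
      exact (h1 : s t ω = _).symm.trans h2
    · exact fun p _ => hs (measurableSet_singleton _)
  refine Measure.ext_of_singleton fun y => ?_
  rw [Measure.map_apply hs (measurableSet_singleton y)]
  simp only [Measure.finsetSum_apply, Measure.smul_apply, smul_eq_mul,
    Measure.dirac_apply' _ (measurableSet_singleton y), Set.indicator_apply, Set.mem_singleton_iff,
    Pi.one_apply, mul_ite, mul_one, mul_zero]
  by_cases hy : ∃ p, permSchedule p = y
  · obtain ⟨p, rfl⟩ := hy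
    simp only [permSchedule_injective.eq_iff, Finset.sum_ite_eq', Finset.mem_univ, if_true]
    exact h.uniform_schedule t p
  · push Not at hy
    simp only [hy, if_false, Finset.sum_const_zero]
    refine measure_mono_null ?_ ((prob_compl_eq_zero_iff ?_).2 hrange)
    · intro ω hω
      have hω' : s t ω = y := hω
      simp only [Set.mem_compl_iff, Set.mem_iUnion, Set.mem_ofPred_eq, not_exists]
      intro p _ hp
      exact hy p (hp.symm.trans hω')
    · exact Finset.measurableSet_biUnion _ fun p _ => hs (measurableSet_singleton _)

theorem ae_schedule_le_one [IsProbabilityMeasure μ] (h : IsRandomSwitch μ ε a s q)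
    (t : ℕ) (i j : Fin n) :
    ∀ᵐ ω ∂μ, s t ω i j ≤ 1 := by
  have hm : MeasurableSet {y : SwitchMat n | y i j ≤ 1} := MeasurableSet.of_discrete
  have : ∀ᵐ y ∂(μ.map (s t)), y i j ≤ 1 := by
    rw [h.map_schedule t, ae_iff, Measure.finsetSum_apply]
    refine Finset.sum_eq_zero fun p _ => ?_
    rw [Measure.smul_apply, Measure.dirac_apply' _ MeasurableSet.of_discrete]
    simp [permSchedule_le_one]
  exact (ae_map_iff (h.measurable_schedule t).aemeasurable hm).1 this

theorem integral_schedule [IsProbabilityMeasure μ] (h : IsRandomSwitch μ ε a s q) (hn : n ≠ 0)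
    (t : ℕ) (i j : Fin n) :
    ∫ ω, (s t ω i j : ℝ) ∂μ = 1 / n := by
  rw [← integral_map (f := fun y : SwitchMat n => (y i j : ℝ))
    (h.measurable_schedule t).aemeasurable Measurable.of_discrete.aestronglyMeasurable,
    h.map_schedule t, integral_finsetSum_measure]
  · simp only [integral_smul_measure, integral_dirac, smul_eq_mul, ← Finset.mul_sum]
    have hn' : (n : ℝ) ≠ 0 := by exact_mod_cast hn
    have hf : (n.factorial : ℝ) ≠ 0 := by exact_mod_cast n.factorial_ne_zero
    have := sum_permSchedule i j
    simp only [ENNReal.toReal_inv, ENNReal.toReal_natCast]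
    field_simp
    linarith
  · intro p _
    exact (integrable_dirac (by simp)).smul_measure
      (ENNReal.inv_ne_top.2 (by exact_mod_cast n.factorial_ne_zero))

theorem measurable_input (h : IsRandomSwitch μ ε a s q) (t : ℕ) :
    Measurable fun ω => (a t ω, s t ω) :=
  (h.measurable_arrival t).prodMk (h.measurable_schedule t)

theorem measure_arrival_eq (h : IsRandomSwitch μ ε a s q) (t : ℕ) (x : SwitchMat n) :
    μ (a t ⁻¹' {x}) = ∏ p : Fin n × Fin n, μ ((fun ω => a t ω p.1 p.2) ⁻¹' {x p.1 p.2}) := by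
  have h1 := h.indep_arrival.precomp (g := fun p : Fin n × Fin n => (t, p)) fun p p' hp => by
    simpa using hp
  rw [iIndepFun_iff_measure_inter_preimage_eq_mul] at h1
  have h2 := h1 Finset.univ (sets := fun p => {x p.1 p.2}) fun p _ => measurableSet_singleton _
  rw [← h2]
  congr 1
  ext ω
  simp [funext_iff]

theorem iIndepFun_arrival (h : IsRandomSwitch μ ε a s q) : iIndepFun a μ := by
  refine iIndepFun_of_singleton h.measurable_arrival fun T x => ?_
  have h1 := iIndepFun_iff_measure_inter_preimage_eq_mul.1 h.indep_arrival
    (T ×ˢ Finset.univ) (sets := fun p => {x p.1 p.2.1 p.2.2}) fun p _ => measurableSet_singleton _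
  rw [Finset.prod_product] at h1
  simp only [h.measure_arrival_eq]
  rw [← h1]
  congr 1
  ext ω
  simp only [Set.mem_iInter, Set.mem_preimage, Set.mem_singleton_iff, funext_iff,
    Finset.mem_product, Finset.mem_univ, and_true]
  exact ⟨fun H p hp => H p.1 hp p.2.1 p.2.2, fun H t ht i j => H (t, i, j) ht⟩

theorem iIndepFun_input (h : IsRandomSwitch μ ε a s q) :
    iIndepFun (fun t ω => (a t ω, s t ω)) μ := by
  have key (T : Finset ℕ) (x : ℕ → SwitchMat n × SwitchMat n) :
      μ (⋂ t ∈ T, (fun ω => (a t ω, s t ω)) ⁻¹' {x t})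
        = (∏ t ∈ T, μ (a t ⁻¹' {(x t).1})) * ∏ t ∈ T, μ (s t ⁻¹' {(x t).2}) := by
    rw [← iIndepFun_iff_measure_inter_preimage_eq_mul.1 h.iIndepFun_arrival T
        (sets := fun t => {(x t).1}) fun t _ => measurableSet_singleton _,
      ← iIndepFun_iff_measure_inter_preimage_eq_mul.1 h.indep_schedule T
        (sets := fun t => {(x t).2}) fun t _ => measurableSet_singleton _]
    have hm (z : ℕ → SwitchMat n) : MeasurableSet {w : ℕ → SwitchMat n | ∀ t ∈ T, w t = z t} := by
      have : {w : ℕ → SwitchMat n | ∀ t ∈ T, w t = z t}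
          = ⋂ t ∈ T, (fun w => w t) ⁻¹' {z t} := by ext; simp
      rw [this]
      exact Finset.measurableSet_biInter _ fun t _ =>
        measurable_pi_apply t (measurableSet_singleton _)
    have := h.indep_arrival_schedule.measure_inter_preimage_eq_mul _ _ (hm fun t => (x t).1)
      (hm fun t => (x t).2)
    convert this using 2
    · ext ω
      simp only [Set.mem_iInter, Set.mem_preimage, Set.mem_singleton_iff, Set.mem_inter_iff,
        Set.mem_ofPred_eq, Prod.ext_iff]
      exact ⟨fun H => ⟨fun t ht => (H t ht).1, fun t ht => (H t ht).2⟩,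
        fun H t ht => ⟨H.1 t ht, H.2 t ht⟩⟩
    · congr 1
      ext ω
      simp
    · congr 1
      ext ω
      simp
  refine iIndepFun_of_singleton h.measurable_input fun T x => ?_
  rw [key, ← Finset.prod_mul_distrib]
  refine Finset.prod_congr rfl fun t _ => ?_
  -- On a singleton, `key` is the factorization within one time slot.
  simpa using (key {t} x).symm

theorem map_arrival (h : IsRandomSwitch μ ε a s q) (t : ℕ) : μ.map (a t) = μ.map (a 0) := by
  refine Measure.ext_of_singleton fun y => ?_
  rw [Measure.map_apply (h.measurable_arrival t) (measurableSet_singleton y),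
    Measure.map_apply (h.measurable_arrival 0) (measurableSet_singleton y),
    h.measure_arrival_eq, h.measure_arrival_eq]
  exact Finset.prod_congr rfl fun p _ =>
    (h.ident_arrival t p.1 p.2).measure_preimage_eq (measurableSet_singleton _)

theorem indepFun_arrival_schedule (h : IsRandomSwitch μ ε a s q) (t : ℕ) :
    IndepFun (a t) (s t) μ :=
  h.indep_arrival_schedule.comp (measurable_pi_apply t) (measurable_pi_apply t)

theorem map_input [IsProbabilityMeasure μ] (h : IsRandomSwitch μ ε a s q) (t : ℕ) :
    μ.map (fun ω => (a t ω, s t ω)) = μ.map (fun ω => (a 0 ω, s 0 ω)) := by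
  rw [(h.indepFun_arrival_schedule t).map_prod_eq_prod_map_map
      (h.measurable_arrival t).aemeasurable (h.measurable_schedule t).aemeasurable,
    (h.indepFun_arrival_schedule 0).map_prod_eq_prod_map_map
      (h.measurable_arrival 0).aemeasurable (h.measurable_schedule 0).aemeasurable,
    h.map_arrival, h.map_schedule t, h.map_schedule 0]

theorem indepFun_init_input (h : IsRandomSwitch μ ε a s q) :
    IndepFun (q 0) (fun ω t => (a t ω, s t ω)) μ :=
  h.indep_init.comp (ψ := fun (p : (ℕ → SwitchMat n) × (ℕ → SwitchMat n)) t => (p.1 t, p.2 t))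
    measurable_id (by fun_prop)

/-- Without arrivals, each schedule is used with positive probability. -/
theorem queueTransition_pos (h : IsRandomSwitch μ ε a s q) (x : SwitchMat n)
    (p : Equiv.Perm (Fin n)) : 0 < queueTransition μ a s x (queueStep x 0 (permSchedule p)) := by
  have h1 := (h.indepFun_arrival_schedule 0).measure_inter_preimage_eq_mul {0} {permSchedule p}
    (measurableSet_singleton _) (measurableSet_singleton _)
  have h2 : 0 < μ (a 0 ⁻¹' {0} ∩ s 0 ⁻¹' {permSchedule p}) := by
    rw [h1]
    refine ENNReal.mul_pos (h.no_arrival 0).ne' ?_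
    have : μ (s 0 ⁻¹' {permSchedule p}) = _ := h.uniform_schedule 0 p
    rw [this]
    exact ENNReal.inv_ne_zero.2 (ENNReal.natCast_ne_top _)
  refine h2.trans_le (measure_mono fun ω hω => ?_)
  have h3 : a 0 ω = 0 := hω.1
  have h4 : s 0 ω = permSchedule p := hω.2
  simp [h3, h4]

/-- A nonempty queue `(i, j)` is served by the permutation `swap i j`; without arrivals the total
content then strictly decreases. -/
theorem zero_mem_reachableFrom (h : IsRandomSwitch μ ε a s q) (x : SwitchMat n) :
    0 ∈ reachableFrom (queueTransition μ a s) x := by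
  induction hN : ∑ i, ∑ j, x i j using Nat.strong_induction_on generalizing x with
  | _ N ih =>
    by_cases hx : x = 0
    · rw [hx]
      exact mem_reachableFrom_self 0
    · obtain ⟨i, j, hij⟩ : ∃ i j, x i j ≠ 0 := by
        by_contra! H
        exact hx (funext fun i => funext fun j => H i j)
      refine reachableFrom_trans
        (mem_reachableFrom_of_pos (h.queueTransition_pos x (Equiv.swap i j))) (ih _ ?_ _ rfl)
      rw [← hN]
      have hle (i' j' : Fin n) :
          queueStep x 0 (permSchedule (Equiv.swap i j)) i' j' ≤ x i' j' := by
        simp [queueStep]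
      refine Finset.sum_lt_sum (fun i' _ => Finset.sum_le_sum fun j' _ => hle i' j')
        ⟨i, Finset.mem_univ _, Finset.sum_lt_sum (fun j' _ => hle i j') ⟨j, Finset.mem_univ _, ?_⟩⟩
      simp [queueStep, permSchedule]
      omega

theorem queueTransition_zero_pos (h : IsRandomSwitch μ ε a s q) :
    0 < queueTransition μ a s 0 0 := by
  have := h.queueTransition_pos 0 1
  have e : queueStep (0 : SwitchMat n) 0 (permSchedule 1) = 0 := by
    funext i j
    simp [queueStep]
  rwa [e] at this

theorem isMarkovChain [IsProbabilityMeasure μ] (h : IsRandomSwitch μ ε a s q) :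
    IsMarkovChain μ q (queueTransition μ a s) :=
  isMarkovChain_of_recursion (W := fun t ω => (a t ω, s t ω))
    (F := fun (x : SwitchMat n) (v : SwitchMat n × SwitchMat n) => queueStep x v.1 v.2)
    h.measurable_input h.iIndepFun_input h.map_input
    h.measurable_init h.indepFun_init_input h.queue_succ

end IsRandomSwitch

/-! ### Drift bounds and integrability. -/

section Telescoping

/-- If `f ≥ 0` has increments at most `C - c * g` and `g` is monotone, then `g ≤ C / c`. -/
theorem le_div_of_increment_le {f g : ℕ → ℝ} {c C : ℝ} (hc : 0 < c) (hf : ∀ t, 0 ≤ f t)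
    (hg : Monotone g) (h : ∀ t, f (t + 1) ≤ f t - c * g t + C) (t : ℕ) : g t ≤ C / c := by
  by_contra! hlt
  rw [div_lt_iff₀ hc] at hlt
  -- If the bound failed at `t`, monotonicity of `g` would make `f` lose at least `η` in every later
  -- step and become negative.
  set η := g t * c - C with hη
  have hη0 : 0 < η := by linarith
  have key (k : ℕ) : f (t + k) ≤ f t - k * η := by
    induction k with
    | zero => simp
    | succ k ih =>
      have h1 := h (t + k)
      have h2 : c * g t ≤ c * g (t + k) :=
        mul_le_mul_of_nonneg_left (hg (Nat.le_add_right t k)) hc.le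
      rw [← add_assoc]
      push_cast
      linarith
  obtain ⟨k, hk⟩ := exists_nat_gt (f t / η)
  rw [div_lt_iff₀ hη0] at hk
  linarith [key k, hf (t + k)]

theorem integrable_comp_of_ae_mem_finite {Ω T : Type*} [MeasurableSpace Ω] {μ : Measure Ω}
    [IsFiniteMeasure μ] [MeasurableSpace T] [DiscreteMeasurableSpace T] {Y : Ω → T}
    (hY : Measurable Y) {A : Set T} (hA : A.Finite) (hYA : ∀ᵐ ω ∂μ, Y ω ∈ A) (f : T → ℝ) :
    Integrable (fun ω => f (Y ω)) μ := by
  refine Integrable.of_bound (Measurable.of_discrete.comp hY).aestronglyMeasurable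
    (∑ y ∈ hA.toFinset, ‖f y‖) ?_
  filter_upwards [hYA] with ω hω
  exact Finset.single_le_sum (f := fun y => ‖f y‖) (fun y _ => norm_nonneg _)
    (hA.mem_toFinset.2 hω)

end Telescoping

/-! ### The scalar queue: equilibrium mean and coupling. -/

section ScalarQueue

/-- The mean of a stable scalar queue, started empty and served at most one at a time, converges to
the value given by the equilibrium of the second moment. -/
theorem tendsto_mean_queue {Ω : Type*} [MeasurableSpace Ω] {μ : Measure Ω}
    [IsProbabilityMeasure μ] {x A Z : ℕ → Ω → ℕ} {K : ℕ} {δ c : ℝ} (hδ : 0 < δ)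
    (hx : ∀ t, Measurable (x t)) (hA : ∀ t, Measurable (A t)) (hZ : ∀ t, Measurable (Z t))
    (h0 : ∀ ω, x 0 ω = 0) (hsucc : ∀ t ω, x (t + 1) ω = x t ω + A t ω - Z t ω)
    (hAK : ∀ t, ∀ᵐ ω ∂μ, A t ω ≤ K) (hZ1 : ∀ t, ∀ᵐ ω ∂μ, Z t ω ≤ 1)
    (hind : ∀ t, IndepFun (x t) (fun ω => (A t ω, Z t ω)) μ)
    (hdrift : ∀ t, ∫ ω, ((A t ω : ℝ) - Z t ω) ∂μ = -δ)
    (hsq : ∀ t, ∫ ω, ((A t ω : ℝ) - Z t ω) ^ 2 ∂μ = c)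
    (hmono1 : Monotone fun t => ∫ ω, (x t ω : ℝ) ∂μ)
    (hmono2 : Monotone fun t => ∫ ω, (x t ω : ℝ) ^ 2 ∂μ) :
    Tendsto (fun t => ∫ ω, (x t ω : ℝ) ∂μ) atTop (𝓝 ((c - δ) / (2 * δ))) := by
  have hxb (t : ℕ) : ∀ᵐ ω ∂μ, x t ω ≤ t * K := by
    induction t with
    | zero => exact ae_of_all _ fun ω => by simp [h0]
    | succ t ih =>
      filter_upwards [ih, hAK t] with ω h1 h2
      rw [hsucc, add_mul, one_mul]
      omega
  have hfint (t : ℕ) (f : ℕ × ℕ × ℕ → ℝ) : Integrable (fun ω => f (x t ω, A t ω, Z t ω)) μ := by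
    refine integrable_comp_of_ae_mem_finite ((hx t).prodMk ((hA t).prodMk (hZ t)))
      (Set.finite_Iic ((t * K, K, 1) : ℕ × ℕ × ℕ)) ?_ f
    filter_upwards [hxb t, hAK t, hZ1 t] with ω h1 h2 h3
    exact ⟨h1, h2, h3⟩
  have hprod (t : ℕ) (f : ℕ → ℝ) (g : ℕ × ℕ → ℝ) :
      ∫ ω, f (x t ω) * g (A t ω, Z t ω) ∂μ
        = (∫ ω, f (x t ω) ∂μ) * ∫ ω, g (A t ω, Z t ω) ∂μ :=
    (hind t).integral_fun_comp_mul_comp (hx t).aemeasurable ((hA t).prodMk (hZ t)).aemeasurable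
      Measurable.of_discrete.aestronglyMeasurable Measurable.of_discrete.aestronglyMeasurable
  set m1 : ℕ → ℝ := fun t => ∫ ω, (x t ω : ℝ) ∂μ with hm1
  set m2 : ℕ → ℝ := fun t => ∫ ω, (x t ω : ℝ) ^ 2 ∂μ with hm2
  set m3 : ℕ → ℝ := fun t => ∫ ω, (x t ω : ℝ) ^ 3 ∂μ with hm3
  -- Since `Z ≤ 1`, service is unused only if `x = A = 0` and `Z = 1`. Truncation then replaces `-1`
  -- by `0`: it adds 1 to the first power and removes 1 from the square.
  set u : ℕ → ℝ := fun t => ∫ ω, (if x t ω + A t ω < Z t ω then 1 else 0 : ℝ) ∂μ with hu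
  have hu0 (t : ℕ) : 0 ≤ u t := integral_nonneg fun ω => by
    show (0 : ℝ) ≤ if _ then _ else _
    split_ifs <;> simp
  have E1 (t : ℕ) : m1 (t + 1) = m1 t - δ + u t := by
    have : m1 (t + 1) = ∫ ω, ((x t ω : ℝ) + ((A t ω : ℝ) - Z t ω)
        + (if x t ω + A t ω < Z t ω then 1 else 0 : ℝ)) ∂μ := by
      refine integral_congr_ae ?_
      filter_upwards [hZ1 t] with ω hω
      rw [hsucc]
      split_ifs with h
      · have h1 : x t ω = 0 := by omega
        have h2 : A t ω = 0 := by omega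
        have h3 : Z t ω = 1 := by omega
        simp [h1, h2, h3]
      · rw [Nat.cast_sub (not_lt.1 h)]
        push_cast
        ring
    rw [this, integral_add, integral_add, hdrift]
    · simp only [hm1, hu]; ring
    · exact hfint t fun p => (p.1 : ℝ)
    · exact hfint t fun p => (p.2.1 : ℝ) - p.2.2
    · exact hfint t fun p => (p.1 : ℝ) + ((p.2.1 : ℝ) - p.2.2)
    · exact hfint t fun p => if p.1 + p.2.1 < p.2.2 then 1 else 0
  have E2 (t : ℕ) : m2 (t + 1) = m2 t - 2 * δ * m1 t + c - u t := by
    have : m2 (t + 1) = ∫ ω, ((x t ω : ℝ) ^ 2 + 2 * ((x t ω : ℝ) * ((A t ω : ℝ) - Z t ω))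
        + ((A t ω : ℝ) - Z t ω) ^ 2 - (if x t ω + A t ω < Z t ω then 1 else 0 : ℝ)) ∂μ := by
      refine integral_congr_ae ?_
      filter_upwards [hZ1 t] with ω hω
      rw [hsucc]
      split_ifs with h
      · have h1 : x t ω = 0 := by omega
        have h2 : A t ω = 0 := by omega
        have h3 : Z t ω = 1 := by omega
        simp [h1, h2, h3]
      · rw [Nat.cast_sub (not_lt.1 h)]
        push_cast
        ring
    rw [this, integral_sub, integral_add, integral_add, integral_const_mul,
      hprod t (fun k => (k : ℝ)) (fun p => (p.1 : ℝ) - p.2), hdrift, hsq]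
    · simp only [hm1, hm2, hu]; ring
    · exact hfint t fun p => (p.1 : ℝ) ^ 2
    · exact hfint t fun p => 2 * ((p.1 : ℝ) * ((p.2.1 : ℝ) - p.2.2))
    · exact hfint t fun p => (p.1 : ℝ) ^ 2 + 2 * ((p.1 : ℝ) * ((p.2.1 : ℝ) - p.2.2))
    · exact hfint t fun p => ((p.2.1 : ℝ) - p.2.2) ^ 2
    · exact hfint t fun p => (p.1 : ℝ) ^ 2 + 2 * ((p.1 : ℝ) * ((p.2.1 : ℝ) - p.2.2))
        + ((p.2.1 : ℝ) - p.2.2) ^ 2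
    · exact hfint t fun p => if p.1 + p.2.1 < p.2.2 then 1 else 0
  have hB1 (t : ℕ) : m1 t ≤ c / (2 * δ) :=
    le_div_of_increment_le (f := m2) (by linarith)
      (fun t => integral_nonneg fun ω => by positivity) hmono1
      (fun t => by have := E2 t; have := hu0 t; linarith) t
  have hc : 0 ≤ c := hsq 0 ▸ integral_nonneg fun ω => by positivity
  -- The cubic drift serves only to bound `m2`. In the constant, `3 * c * (c / (2 * δ))` comes from
  -- the bound on `m1`, and `K ^ 3 + 1` dominates `(A - Z) ^ 3`.
  have E3 (t : ℕ) : m3 (t + 1) ≤ m3 t - 3 * δ * m2 t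
      + (3 * c * (c / (2 * δ)) + ((K : ℝ) ^ 3 + 1)) := by
    have h1 : m3 (t + 1) ≤ ∫ ω, ((x t ω : ℝ) ^ 3 + 3 * ((x t ω : ℝ) ^ 2 * ((A t ω : ℝ) - Z t ω))
        + 3 * ((x t ω : ℝ) * ((A t ω : ℝ) - Z t ω) ^ 2) + ((K : ℝ) ^ 3 + 1)) ∂μ := by
      refine integral_mono_ae (hfint (t + 1) fun p => (p.1 : ℝ) ^ 3)
        (hfint t fun p => (p.1 : ℝ) ^ 3 + 3 * ((p.1 : ℝ) ^ 2 * ((p.2.1 : ℝ) - p.2.2))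
          + 3 * ((p.1 : ℝ) * ((p.2.1 : ℝ) - p.2.2) ^ 2) + ((K : ℝ) ^ 3 + 1)) ?_
      filter_upwards [hZ1 t, hAK t] with ω hω hω'
      simp only [hsucc]
      have hd : ((A t ω : ℝ) - Z t ω) ^ 3 ≤ (K : ℝ) ^ 3 := by
        refine (Odd.strictMono_pow ⟨1, rfl⟩).monotone ?_
        have : (A t ω : ℝ) ≤ K := by exact_mod_cast hω'
        have : (0 : ℝ) ≤ Z t ω := Nat.cast_nonneg _
        linarith
      by_cases h : x t ω + A t ω < Z t ω
      · have h1 : x t ω = 0 := by omega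
        have h2 : A t ω = 0 := by omega
        have h3 : Z t ω = 1 := by omega
        simp only [h1, h2, h3]
        norm_num
        positivity
      · rw [Nat.cast_sub (not_lt.1 h)]
        push_cast
        nlinarith [hd]
    rw [integral_add, integral_add, integral_add, integral_const_mul, integral_const_mul,
      hprod t (fun k => (k : ℝ) ^ 2) (fun p => (p.1 : ℝ) - p.2),
      hprod t (fun k => (k : ℝ)) (fun p => ((p.1 : ℝ) - p.2) ^ 2), hdrift, hsq] at h1
    · simp only [integral_const, probReal_univ, one_smul] at h1
      have := mul_le_mul_of_nonneg_left (hB1 t) (by linarith : (0 : ℝ) ≤ 3 * c)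
      simp only [hm1, hm2, hm3] at *
      linarith
    · exact hfint t fun p => (p.1 : ℝ) ^ 3
    · exact hfint t fun p => 3 * ((p.1 : ℝ) ^ 2 * ((p.2.1 : ℝ) - p.2.2))
    · exact hfint t fun p => (p.1 : ℝ) ^ 3 + 3 * ((p.1 : ℝ) ^ 2 * ((p.2.1 : ℝ) - p.2.2))
    · exact hfint t fun p => 3 * ((p.1 : ℝ) * ((p.2.1 : ℝ) - p.2.2) ^ 2)
    · exact hfint t fun p => (p.1 : ℝ) ^ 3 + 3 * ((p.1 : ℝ) ^ 2 * ((p.2.1 : ℝ) - p.2.2))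
        + 3 * ((p.1 : ℝ) * ((p.2.1 : ℝ) - p.2.2) ^ 2)
    · exact integrable_const _
  have hB2 (t : ℕ) : m2 t ≤ _ :=
    le_div_of_increment_le (f := m3) (by linarith : 0 < 3 * δ)
      (fun t => integral_nonneg fun ω => by positivity) hmono2 E3 t
  obtain ⟨L1, hL1⟩ : ∃ L, Tendsto m1 atTop (𝓝 L) :=
    ⟨_, tendsto_atTop_ciSup hmono1 ⟨_, Set.forall_mem_range.2 hB1⟩⟩
  obtain ⟨L2, hL2⟩ : ∃ L, Tendsto m2 atTop (𝓝 L) :=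
    ⟨_, tendsto_atTop_ciSup hmono2 ⟨_, Set.forall_mem_range.2 hB2⟩⟩
  -- Adding the two balances eliminates the unknown `u t`; the increments vanish in the limit.
  have hsum (t : ℕ) : m2 (t + 1) - m2 t + (m1 (t + 1) - m1 t) + 2 * δ * m1 t = c - δ := by
    rw [E1, E2]; ring
  have hlim := ((((tendsto_add_atTop_iff_nat 1).2 hL2).sub hL2).add
    (((tendsto_add_atTop_iff_nat 1).2 hL1).sub hL1)).add (hL1.const_mul (2 * δ))
  simp only [hsum] at hlim
  have := tendsto_nhds_unique tendsto_const_nhds hlim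
  have hL : (c - δ) / (2 * δ) = L1 := by
    rw [div_eq_iff (by positivity), this]; ring
  rw [hL]
  exact hL1

/-- Two scalar queues with the same inputs, one of them started empty, agree once the net input has
used up the initial content of the other. -/
theorem queue_coupling {x y A Z : ℕ → ℕ} (hx : ∀ t, x (t + 1) = x t + A t - Z t)
    (hy : ∀ t, y (t + 1) = y t + A t - Z t) (hy0 : y 0 = 0) {T : ℕ}
    (hT : (x 0 : ℝ) + ∑ k ∈ Finset.range T, ((A k : ℝ) - Z k) < 0) {t : ℕ} (ht : T ≤ t) :
    x t = y t := by
  have hle (k : ℕ) : y k ≤ x k := by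
    induction k with
    | zero => simp [hy0]
    | succ k ih => rw [hx, hy]; omega
  have hfwd {k l : ℕ} (hkl : k ≤ l) (h : x k = y k) : x l = y l := by
    induction l, hkl using Nat.le_induction with
    | base => exact h
    | succ l _ ih => rw [hx, hy, ih]
  -- Without truncation before `T`, `x T` would equal the negative quantity in `hT`. At a truncation
  -- `x` drops to 0, forcing the smaller `y` to 0, and the two stay equal from then on.
  obtain ⟨k, hk, hlt⟩ : ∃ k < T, x k + A k < Z k := by
    by_contra! H
    have key (k : ℕ) (hk : k ≤ T) :
        (x k : ℝ) = x 0 + ∑ l ∈ Finset.range k, ((A l : ℝ) - Z l) := by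
      induction k with
      | zero => simp
      | succ k ih =>
        rw [hx, Nat.cast_sub (H k (by omega)), Finset.sum_range_succ, ← add_assoc,
          ← ih (by omega)]
        push_cast
        ring
    have := key T le_rfl
    have h0 : (0 : ℝ) ≤ x T := Nat.cast_nonneg _
    linarith
  refine hfwd (show k + 1 ≤ t by omega) ?_
  have h1 : x (k + 1) = 0 := by rw [hx]; omega
  have h2 := hle (k + 1)
  omega

theorem exists_add_lt_zero_of_tendsto_div {f : ℕ → ℝ} {δ : ℝ} (hδ : 0 < δ)
    (hf : Tendsto (fun t : ℕ => f t / t) atTop (𝓝 (-δ))) (b : ℝ) : ∃ T, b + f T < 0 := by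
  have h1 : ∀ᶠ t : ℕ in atTop, f t / t < -(δ / 2) := hf.eventually_lt_const (by linarith)
  have h2 : ∀ᶠ t : ℕ in atTop, b < δ / 2 * t :=
    (tendsto_natCast_atTop_atTop.const_mul_atTop (by positivity)).eventually_gt_atTop b
  obtain ⟨t, h1, h2, h3⟩ := (h1.and (h2.and (eventually_gt_atTop 0))).exists
  refine ⟨t, ?_⟩
  have : (0 : ℝ) < t := by exact_mod_cast h3
  rw [div_lt_iff₀ this] at h1
  linarith

end ScalarQueue

/-! ### Equilibrium of the switch. -/

/-- The queue lengths after one time slot, as a function of the pair of arrivals and schedule. -/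
def switchStep {n : ℕ} (x : SwitchMat n) (v : SwitchMat n × SwitchMat n) : SwitchMat n :=
  queueStep x v.1 v.2

theorem monotone_switchStep {n : ℕ} (v : SwitchMat n × SwitchMat n) :
    Monotone fun x : SwitchMat n => switchStep x v := fun x y hxy i j => by
  have : x i j ≤ y i j := hxy i j
  simp only [switchStep, queueStep]
  omega

theorem monotone_backwardOrbit_switchStep {n : ℕ} (w : ℕ → SwitchMat n × SwitchMat n)
    (i j : Fin n) : Monotone fun t => backwardOrbit switchStep 0 t w i j :=
  monotone_nat_of_le_succ fun t =>
    backwardOrbit_le_succ monotone_switchStep (fun _ _ _ => Nat.zero_le _) t w i j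

namespace IsRandomSwitch

variable {n : ℕ} {Ω : Type*} [MeasurableSpace Ω] {μ : Measure Ω} {ε : ℝ}
  {a s q : ℕ → Ω → SwitchMat n}

theorem measurable_drivenOrbit_input (h : IsRandomSwitch μ ε a s q) (t : ℕ) :
    Measurable fun ω => drivenOrbit switchStep 0 (fun k => (a k ω, s k ω)) t :=
  (measurable_drivenOrbit switchStep t).comp
    (measurable_const.prodMk (measurable_pi_lambda _ h.measurable_input))

theorem measurable_backwardOrbit_input (h : IsRandomSwitch μ ε a s q) (t : ℕ) :
    Measurable fun ω => backwardOrbit switchStep 0 t fun k => (a k ω, s k ω) :=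
  (measurable_backwardOrbit switchStep 0 t).comp (measurable_pi_lambda _ h.measurable_input)

variable [IsProbabilityMeasure μ]

theorem integral_input_eq (h : IsRandomSwitch μ ε a s q) (f : SwitchMat n × SwitchMat n → ℝ)
    (t : ℕ) : ∫ ω, f (a t ω, s t ω) ∂μ = ∫ ω, f (a 0 ω, s 0 ω) ∂μ := by
  rw [← integral_map (f := f) (h.measurable_input t).aemeasurable
      Measurable.of_discrete.aestronglyMeasurable, h.map_input,
    integral_map (h.measurable_input 0).aemeasurable Measurable.of_discrete.aestronglyMeasurable]

theorem integrable_input (h : IsRandomSwitch μ ε a s q) (i j : Fin n) (t : ℕ)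
    (f : ℕ × ℕ → ℝ) : Integrable (fun ω => f (a t ω i j, s t ω i j)) μ := by
  obtain ⟨K, hK⟩ := h.bounded_arrival
  refine integrable_comp_of_ae_mem_finite (Y := fun ω => (a t ω i j, s t ω i j))
    ((Measurable.of_discrete (f := fun v : SwitchMat n × SwitchMat n => (v.1 i j, v.2 i j))).comp
      (h.measurable_input t)) (Set.finite_Iic ((K, 1) : ℕ × ℕ)) ?_ f
  filter_upwards [hK t i j, h.ae_schedule_le_one t i j] with ω h1 h2
  exact ⟨h1, h2⟩

theorem integral_net_input (h : IsRandomSwitch μ ε a s q) (hn : n ≠ 0) (t : ℕ) (i j : Fin n) :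
    ∫ ω, ((a t ω i j : ℝ) - s t ω i j) ∂μ = -(ε / n) := by
  rw [integral_sub (h.integrable_input i j t fun p => p.1)
    (h.integrable_input i j t fun p => p.2), h.mean_arrival, h.integral_schedule hn]
  ring

theorem variance_arrival (h : IsRandomSwitch μ ε a s q) (i j : Fin n) :
    variance (fun ω => (a 0 ω i j : ℝ)) μ
      = ∫ ω, (a 0 ω i j : ℝ) ^ 2 ∂μ - ((1 - ε) / n) ^ 2 := by
  rw [← h.mean_arrival 0 i j]
  refine variance_eq_sub ?_
  rw [memLp_two_iff_integrable_sq (h.integrable_input i j 0 fun p => p.1).aestronglyMeasurable]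
  exact h.integrable_input i j 0 fun p => (p.1 : ℝ) ^ 2

theorem variance_arrival_of_bernoulli (h : IsRandomSwitch μ ε a s q) {i j : Fin n}
    (hb : ∀ᵐ ω ∂μ, a 0 ω i j = 0 ∨ a 0 ω i j = 1) :
    variance (fun ω => (a 0 ω i j : ℝ)) μ = (1 - ε) / n - ((1 - ε) / n) ^ 2 := by
  rw [h.variance_arrival, ← h.mean_arrival 0 i j]
  congr 1
  refine integral_congr_ae ?_
  filter_upwards [hb] with ω hω
  rcases hω with hω | hω <;> simp [hω]

/-- Arrivals and schedule are independent, so their variances add to the squared drift; an entry of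
the schedule is Bernoulli with mean `1 / n`. -/
theorem integral_net_input_sq (h : IsRandomSwitch μ ε a s q) (hn : n ≠ 0) (t : ℕ) (i j : Fin n) :
    ∫ ω, ((a t ω i j : ℝ) - s t ω i j) ^ 2 ∂μ
      = variance (fun ω => (a 0 ω i j : ℝ)) μ + 1 / n * (1 - 1 / n) + (ε / n) ^ 2 := by
  rw [h.integral_input_eq (fun v => ((v.1 i j : ℝ) - v.2 i j) ^ 2) t]
  have h1 : ∫ ω, ((a 0 ω i j : ℝ) - s 0 ω i j) ^ 2 ∂μ
      = ∫ ω, ((a 0 ω i j : ℝ) ^ 2 - 2 * ((a 0 ω i j : ℝ) * (s 0 ω i j : ℝ)) + s 0 ω i j) ∂μ := by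
    refine integral_congr_ae ?_
    filter_upwards [h.ae_schedule_le_one 0 i j] with ω hω
    have : (s 0 ω i j : ℝ) ^ 2 = s 0 ω i j := by
      interval_cases s 0 ω i j <;> simp
    linear_combination this
  have h2 : ∫ ω, (a 0 ω i j : ℝ) * (s 0 ω i j : ℝ) ∂μ
      = (∫ ω, (a 0 ω i j : ℝ) ∂μ) * ∫ ω, (s 0 ω i j : ℝ) ∂μ :=
    (h.indepFun_arrival_schedule 0).integral_fun_comp_mul_comp
      (f := fun x : SwitchMat n => (x i j : ℝ)) (g := fun x : SwitchMat n => (x i j : ℝ))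
      (h.measurable_arrival 0).aemeasurable (h.measurable_schedule 0).aemeasurable
      Measurable.of_discrete.aestronglyMeasurable Measurable.of_discrete.aestronglyMeasurable
  rw [h1, integral_add (h.integrable_input i j 0 fun p => (p.1 : ℝ) ^ 2 - 2 * ((p.1 : ℝ) * p.2))
      (h.integrable_input i j 0 fun p => p.2),
    integral_sub (h.integrable_input i j 0 fun p => (p.1 : ℝ) ^ 2)
      (h.integrable_input i j 0 fun p => 2 * ((p.1 : ℝ) * p.2)), integral_const_mul, h2,
    h.variance_arrival, h.mean_arrival, h.integral_schedule hn]
  ring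

/-- Almost surely, the queue lengths eventually agree with those of the switch started empty. -/
theorem ae_eventually_eq_drivenOrbit (h : IsRandomSwitch μ ε a s q) (hn : n ≠ 0) (hε : 0 < ε) :
    ∀ᵐ ω ∂μ, ∀ᶠ t in atTop,
      q t ω = drivenOrbit switchStep 0 (fun k => (a k ω, s k ω)) t := by
  have hn' : (0 : ℝ) < n := by exact_mod_cast Nat.pos_of_ne_zero hn
  have hslln (i j : Fin n) : ∀ᵐ ω ∂μ, Tendsto
      (fun T : ℕ => (∑ k ∈ Finset.range T, ((a k ω i j : ℝ) - s k ω i j)) / T) atTop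
      (𝓝 (-(ε / n))) := by
    rw [← h.integral_net_input hn 0 i j]
    have hm : Measurable fun v : SwitchMat n × SwitchMat n => ((v.1 i j : ℝ) - v.2 i j) :=
      Measurable.of_discrete
    refine strong_law_ae_real (fun k ω => (a k ω i j : ℝ) - s k ω i j)
      (h.integrable_input i j 0 fun p => (p.1 : ℝ) - p.2) (fun k l hkl => ?_) fun k => ?_
    · exact (h.iIndepFun_input.indepFun hkl).comp hm hm
    · exact (IdentDistrib.mk (h.measurable_input k).aemeasurable
        (h.measurable_input 0).aemeasurable (h.map_input k)).comp hm
  have hall : ∀ᵐ ω ∂μ, ∀ i j, Tendsto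
      (fun T : ℕ => (∑ k ∈ Finset.range T, ((a k ω i j : ℝ) - s k ω i j)) / T) atTop
      (𝓝 (-(ε / n))) := by
    simpa only [ae_all_iff] using hslln
  filter_upwards [hall] with ω hω
  have hij (i j : Fin n) : ∀ᶠ t in atTop,
      q t ω i j = drivenOrbit switchStep 0 (fun k => (a k ω, s k ω)) t i j := by
    obtain ⟨T, hT⟩ := exists_add_lt_zero_of_tendsto_div (by positivity) (hω i j) (q 0 ω i j)
    filter_upwards [eventually_ge_atTop T] with t ht
    exact queue_coupling (x := fun t => q t ω i j)
      (y := fun t => drivenOrbit switchStep 0 (fun k => (a k ω, s k ω)) t i j)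
      (A := fun t => a t ω i j) (Z := fun t => s t ω i j)
      (fun t => by simp only [h.queue_succ, queueStep]) (fun t => rfl) rfl hT ht
  have := eventually_all.2 fun i => eventually_all.2 (hij i)
  filter_upwards [this] with t ht
  exact funext fun i => funext fun j => ht i j

theorem identDistrib_orbits (h : IsRandomSwitch μ ε a s q) (t : ℕ) :
    IdentDistrib (fun ω => backwardOrbit switchStep 0 t fun k => (a k ω, s k ω))
      (fun ω => drivenOrbit switchStep 0 (fun k => (a k ω, s k ω)) t) μ μ where
  aemeasurable_fst := (h.measurable_backwardOrbit_input t).aemeasurable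
  aemeasurable_snd := (h.measurable_drivenOrbit_input t).aemeasurable
  map_eq := by
    simpa only [Nat.zero_add] using map_backwardOrbit_eq (F := switchStep)
      (W := fun t ω => (a t ω, s t ω)) h.measurable_input h.iIndepFun_input h.map_input 0 t 0

theorem integrable_comp_drivenOrbit (h : IsRandomSwitch μ ε a s q) (t : ℕ) (i j : Fin n)
    (f : ℕ → ℝ) :
    Integrable (fun ω => f (drivenOrbit switchStep 0 (fun k => (a k ω, s k ω)) t i j)) μ := by
  obtain ⟨K, hK⟩ := h.bounded_arrival
  refine integrable_comp_of_ae_mem_finite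
    (Y := fun ω => drivenOrbit switchStep 0 (fun k => (a k ω, s k ω)) t i j)
    ((Measurable.of_discrete (f := fun x : SwitchMat n => x i j)).comp
      (h.measurable_drivenOrbit_input t)) (Set.finite_Iic (t * K)) ?_ f
  induction t with
  | zero => exact ae_of_all _ fun ω => by simp [drivenOrbit]
  | succ t ih =>
    filter_upwards [ih, hK t i j] with ω h1 h2
    simp only [Set.mem_Iic, drivenOrbit, switchStep, queueStep] at h1 ⊢
    rw [add_mul, one_mul]
    omega

theorem integral_backwardOrbit (h : IsRandomSwitch μ ε a s q) (t : ℕ) (i j : Fin n)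
    (f : ℕ → ℝ) :
    ∫ ω, f (backwardOrbit switchStep 0 t (fun k => (a k ω, s k ω)) i j) ∂μ
      = ∫ ω, f (drivenOrbit switchStep 0 (fun k => (a k ω, s k ω)) t i j) ∂μ :=
  ((h.identDistrib_orbits t).comp
    (Measurable.of_discrete (f := fun x : SwitchMat n => f (x i j)))).integral_eq

theorem integrable_comp_backwardOrbit (h : IsRandomSwitch μ ε a s q) (t : ℕ) (i j : Fin n)
    (f : ℕ → ℝ) :
    Integrable (fun ω => f (backwardOrbit switchStep 0 t (fun k => (a k ω, s k ω)) i j)) μ :=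
  ((h.identDistrib_orbits t).comp
    (Measurable.of_discrete (f := fun x : SwitchMat n => f (x i j)))).integrable_iff.2
    (h.integrable_comp_drivenOrbit t i j f)

/-- The forward orbit need not be monotone pathwise; the monotonicity is inherited from the backward
orbit through equality of laws. -/
theorem monotone_integral_drivenOrbit (h : IsRandomSwitch μ ε a s q) (i j : Fin n)
    {f : ℕ → ℝ} (hf : Monotone f) :
    Monotone fun t =>
      ∫ ω, f (drivenOrbit switchStep 0 (fun k => (a k ω, s k ω)) t i j) ∂μ := by
  refine monotone_nat_of_le_succ fun t => ?_
  rw [← h.integral_backwardOrbit, ← h.integral_backwardOrbit]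
  exact integral_mono (h.integrable_comp_backwardOrbit t i j f)
    (h.integrable_comp_backwardOrbit (t + 1) i j f) fun ω =>
      hf (monotone_backwardOrbit_switchStep _ i j (Nat.le_succ t))

/-- The mean length of the queue `(i, j)`, started empty, converges to an explicit value. -/
theorem tendsto_integral_drivenOrbit (h : IsRandomSwitch μ ε a s q) (hn : n ≠ 0) (hε : 0 < ε)
    (i j : Fin n) :
    Tendsto (fun t => ∫ ω, (drivenOrbit switchStep 0 (fun k => (a k ω, s k ω)) t i j : ℝ) ∂μ)
      atTop (𝓝 ((variance (fun ω => (a 0 ω i j : ℝ)) μ + 1 / n * (1 - 1 / n) + (ε / n) ^ 2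
        - ε / n) / (2 * (ε / n)))) := by
  have hn' : (0 : ℝ) < n := by exact_mod_cast Nat.pos_of_ne_zero hn
  obtain ⟨K, hK⟩ := h.bounded_arrival
  refine tendsto_mean_queue (A := fun t ω => a t ω i j) (Z := fun t ω => s t ω i j) (K := K)
    (x := fun t ω => drivenOrbit switchStep 0 (fun k => (a k ω, s k ω)) t i j)
    (by positivity)
    (fun t => (Measurable.of_discrete (f := fun x : SwitchMat n => x i j)).comp
      (h.measurable_drivenOrbit_input t))
    (fun t => (Measurable.of_discrete (f := fun x : SwitchMat n => x i j)).comp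
      (h.measurable_arrival t))
    (fun t => (Measurable.of_discrete (f := fun x : SwitchMat n => x i j)).comp
      (h.measurable_schedule t))
    (fun ω => rfl) (fun t ω => rfl) (fun t => hK t i j) (fun t => h.ae_schedule_le_one t i j)
    (fun t => ?_) (fun t => h.integral_net_input hn t i j)
    (fun t => h.integral_net_input_sq hn t i j)
    (h.monotone_integral_drivenOrbit i j Nat.mono_cast)
    (h.monotone_integral_drivenOrbit i j (f := fun k => (k : ℝ) ^ 2) fun k l hkl => by
      have : (k : ℝ) ≤ l := by exact_mod_cast hkl
      simp only
      gcongr)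
  have := indepFun_state_input (W := fun t ω => (a t ω, s t ω)) (F := switchStep)
    (q := fun t ω => drivenOrbit switchStep 0 (fun k => (a k ω, s k ω)) t) h.measurable_input
    h.iIndepFun_input measurable_const (indepFun_const_left _ _) (fun _ _ => rfl) t
  exact this.comp (Measurable.of_discrete (f := fun x : SwitchMat n => x i j))
    (Measurable.of_discrete (f := fun v : SwitchMat n × SwitchMat n => (v.1 i j, v.2 i j)))

/-- The backward iteration started at `0` is almost surely eventually constant. -/
theorem exists_limit_backwardOrbit (h : IsRandomSwitch μ ε a s q) (hn : n ≠ 0) (hε : 0 < ε) :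
    ∃ M : Ω → SwitchMat n, Measurable M ∧ ∀ᵐ ω ∂μ, ∀ᶠ t in atTop,
      backwardOrbit switchStep 0 t (fun k => (a k ω, s k ω)) = M ω := by
  have hbdd (i j : Fin n) : ∀ᵐ ω ∂μ, ∃ l,
      Tendsto (fun t => backwardOrbit switchStep 0 t (fun k => (a k ω, s k ω)) i j) atTop
        (𝓝 l) := by
    have hm (t : ℕ) : Measurable fun ω =>
        ENNReal.ofReal (backwardOrbit switchStep 0 t (fun k => (a k ω, s k ω)) i j : ℝ) :=
      (Measurable.of_discrete (f := fun x : SwitchMat n => ENNReal.ofReal (x i j : ℝ))).comp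
        (h.measurable_backwardOrbit_input t)
    -- By monotone convergence the supremum has finite mean, hence is almost surely finite, and a
    -- bounded monotone sequence of naturals converges.
    have hfin : ∫⁻ ω, ⨆ t,
        ENNReal.ofReal (backwardOrbit switchStep 0 t (fun k => (a k ω, s k ω)) i j : ℝ) ∂μ ≠ ∞ := by
      rw [lintegral_iSup hm fun t t' htt' ω => by
        exact ENNReal.ofReal_le_ofReal
          (by exact_mod_cast monotone_backwardOrbit_switchStep _ i j htt')]
      obtain ⟨L, hL⟩ : ∃ L, Tendsto (fun t =>
          ∫ ω, (drivenOrbit switchStep 0 (fun k => (a k ω, s k ω)) t i j : ℝ) ∂μ) atTop (𝓝 L) :=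
        ⟨_, h.tendsto_integral_drivenOrbit hn hε i j⟩
      refine ne_top_of_le_ne_top (ENNReal.ofReal_ne_top (r := L)) (iSup_le fun t => ?_)
      rw [← ofReal_integral_eq_lintegral_ofReal
        (h.integrable_comp_backwardOrbit t i j fun k => (k : ℝ))
        (ae_of_all _ fun ω => Nat.cast_nonneg _),
        h.integral_backwardOrbit t i j fun k => (k : ℝ)]
      exact ENNReal.ofReal_le_ofReal
        ((h.monotone_integral_drivenOrbit i j Nat.mono_cast).ge_of_tendsto hL t)
    filter_upwards [ae_lt_top (Measurable.iSup hm) hfin] with ω hω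
    obtain ⟨N, hN⟩ := ENNReal.exists_nat_gt hω.ne
    refine ⟨_, tendsto_atTop_ciSup (monotone_backwardOrbit_switchStep _ i j)
      ⟨N, Set.forall_mem_range.2 fun t => ?_⟩⟩
    have h1 := (le_iSup (fun t => ENNReal.ofReal
      (backwardOrbit switchStep 0 t (fun k => (a k ω, s k ω)) i j : ℝ)) t).trans hN.le
    rw [ENNReal.ofReal_natCast] at h1
    exact_mod_cast h1
  obtain ⟨M, hM, hlim⟩ := measurable_limit_of_tendsto_metrizable_ae (L := atTop) (μ := μ)
    (f := fun t ω => backwardOrbit switchStep 0 t fun k => (a k ω, s k ω))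
    (fun t => (h.measurable_backwardOrbit_input t).aemeasurable) (by
      have : ∀ᵐ ω ∂μ, ∀ i j, ∃ l,
          Tendsto (fun t => backwardOrbit switchStep 0 t (fun k => (a k ω, s k ω)) i j) atTop
          (𝓝 l) := by
        simpa only [ae_all_iff] using hbdd
      filter_upwards [this] with ω hω
      choose l hl using hω
      exact ⟨l, tendsto_pi_nhds.2 fun i => tendsto_pi_nhds.2 fun j => hl i j⟩)
  refine ⟨M, hM, ?_⟩
  filter_upwards [hlim] with ω hω
  rw [nhds_discrete, tendsto_pure] at hω
  exact hω

/-- Monotone convergence along the backward orbit: the mean itself passes to the limit, which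
convergence in distribution alone would not give. -/
theorem integrable_limit_and_integral_eq (h : IsRandomSwitch μ ε a s q) (hn : n ≠ 0) (hε : 0 < ε)
    {M : Ω → SwitchMat n} (hM : Measurable M)
    (hlim : ∀ᵐ ω ∂μ, ∀ᶠ t in atTop,
      backwardOrbit switchStep 0 t (fun k => (a k ω, s k ω)) = M ω) (i j : Fin n) :
    Integrable (fun ω => (M ω i j : ℝ)) μ ∧
      ∫ ω, (M ω i j : ℝ) ∂μ = (variance (fun ω => (a 0 ω i j : ℝ)) μ + 1 / n * (1 - 1 / n)
        + (ε / n) ^ 2 - ε / n) / (2 * (ε / n)) := by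
  have hconv := h.tendsto_integral_drivenOrbit hn hε i j
  have hMm : Measurable fun ω => (M ω i j : ℝ) :=
    (Measurable.of_discrete (f := fun x : SwitchMat n => (x i j : ℝ))).comp hM
  have h1 := lintegral_tendsto_of_tendsto_of_monotone (μ := μ)
    (f := fun t ω =>
      ENNReal.ofReal (backwardOrbit switchStep 0 t (fun k => (a k ω, s k ω)) i j : ℝ))
    (F := fun ω => ENNReal.ofReal (M ω i j : ℝ))
    (fun t => ((Measurable.of_discrete (f := fun x : SwitchMat n =>
      ENNReal.ofReal (x i j : ℝ))).comp (h.measurable_backwardOrbit_input t)).aemeasurable)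
    (ae_of_all _ fun ω t t' htt' => ENNReal.ofReal_le_ofReal
      (Nat.cast_le.2 (monotone_backwardOrbit_switchStep _ i j htt')))
    (hlim.mono fun ω hω => tendsto_const_nhds.congr' (hω.mono fun t ht => by simp only [ht]))
  have h2 (t : ℕ) : ∫⁻ ω, ENNReal.ofReal
      (backwardOrbit switchStep 0 t (fun k => (a k ω, s k ω)) i j : ℝ) ∂μ
      = ENNReal.ofReal
        (∫ ω, (drivenOrbit switchStep 0 (fun k => (a k ω, s k ω)) t i j : ℝ) ∂μ) := by
    rw [← h.integral_backwardOrbit t i j fun k => (k : ℝ)]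
    exact (ofReal_integral_eq_lintegral_ofReal
      (h.integrable_comp_backwardOrbit t i j fun k => (k : ℝ))
      (ae_of_all _ fun ω => Nat.cast_nonneg _)).symm
  simp only [h2] at h1
  have h3 := tendsto_nhds_unique h1 (ENNReal.tendsto_ofReal hconv)
  have h4 : Integrable (fun ω => (M ω i j : ℝ)) μ :=
    (lintegral_ofReal_ne_top_iff_integrable hMm.aestronglyMeasurable
      (ae_of_all _ fun ω => Nat.cast_nonneg _)).1 (h3 ▸ ENNReal.ofReal_ne_top)
  refine ⟨h4, ?_⟩
  rw [← ofReal_integral_eq_lintegral_ofReal h4 (ae_of_all _ fun ω => Nat.cast_nonneg _)] at h3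
  exact (ENNReal.ofReal_eq_ofReal_iff (integral_nonneg fun ω => Nat.cast_nonneg _)
    (ge_of_tendsto' hconv fun t => integral_nonneg fun ω => Nat.cast_nonneg _)).1 h3

theorem isPositiveRecurrentOn (h : IsRandomSwitch μ ε a s q) (hn : n ≠ 0) (hε : 0 < ε) :
    IsPositiveRecurrentOn (queueTransition μ a s) (reachableFrom (queueTransition μ a s) 0) := by
  obtain ⟨M, hM, hlim⟩ := h.exists_limit_backwardOrbit hn hε
  refine isPositiveRecurrentOn_reachableFrom h.isMarkovChain.stochastic h.queueTransition_zero_pos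
    h.zero_mem_reachableFrom (π := fun x => μ {ω | M ω = x})
    (invariant_of_backwardOrbit (W := fun t ω => (a t ω, s t ω)) h.measurable_input
      h.iIndepFun_input h.map_input 0 hM hlim) ?_
  simpa using tsum_measure_mul_eq_lintegral μ hM fun _ => 1

/-- Almost surely, the queue lengths eventually stay in the class of the empty state. -/
theorem ae_eventually_mem_reachableFrom (h : IsRandomSwitch μ ε a s q) (hn : n ≠ 0)
    (hε : 0 < ε) :
    ∀ᵐ ω ∂μ, ∀ᶠ t in atTop, q t ω ∈ reachableFrom (queueTransition μ a s) 0 := by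
  -- The countably many `x` share one null set, so the random current state may be substituted for
  -- `x`.
  have hstep (t : ℕ) : ∀ᵐ ω ∂μ, ∀ x, 0 < queueTransition μ a s x
      (switchStep x (a t ω, s t ω)) := by
    rw [ae_all_iff]
    intro x
    have hlaw (y : SwitchMat n) :
        queueTransition μ a s x y = μ {ω | switchStep x (a t ω, s t ω) = y} := by
      have hm : MeasurableSet {v : SwitchMat n × SwitchMat n | switchStep x v = y} :=
        MeasurableSet.of_discrete
      have := congrArg (fun ν => ν {v | switchStep x v = y}) (h.map_input t)
      simp only [Measure.map_apply (h.measurable_input t) hm,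
        Measure.map_apply (h.measurable_input 0) hm] at this
      exact this.symm
    have hnull : ∀ᵐ ω ∂μ, ∀ y, queueTransition μ a s x y = 0 →
        switchStep x (a t ω, s t ω) ≠ y := by
      rw [ae_all_iff]
      intro y
      by_cases hy : queueTransition μ a s x y = 0
      · rw [hlaw] at hy
        filter_upwards [measure_eq_zero_iff_ae_notMem.1 hy] with ω hω _ using hω
      · exact ae_of_all _ fun ω h => absurd h hy
    filter_upwards [hnull] with ω hω
    exact pos_iff_ne_zero.2 fun H => hω _ H rfl
  filter_upwards [h.ae_eventually_eq_drivenOrbit hn hε, ae_all_iff.2 hstep] with ω hω hpos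
  have hmem (t : ℕ) : drivenOrbit switchStep 0 (fun k => (a k ω, s k ω)) t
      ∈ reachableFrom (queueTransition μ a s) 0 := by
    induction t with
    | zero => exact mem_reachableFrom_self 0
    | succ t ih => exact reachableFrom_trans ih (mem_reachableFrom_of_pos (hpos t _))
  exact hω.mono fun t ht => ht ▸ hmem t

/-- `q t` eventually agrees with the orbit from the empty state, which has the law of the backward
orbit, which converges almost surely to `M`. -/
theorem tendstoInDistribution_limit (h : IsRandomSwitch μ ε a s q) (hn : n ≠ 0) (hε : 0 < ε)
    {M : Ω → SwitchMat n} (hM : Measurable M)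
    (hlim : ∀ᵐ ω ∂μ, ∀ᶠ t in atTop,
      backwardOrbit switchStep 0 t (fun k => (a k ω, s k ω)) = M ω) :
    TendstoInDistribution q atTop M (fun _ => μ) μ where
  forall_aemeasurable t := (h.isMarkovChain.measurable t).aemeasurable
  aemeasurable_limit := hM.aemeasurable
  tendsto := by
    refine ProbabilityMeasure.tendsto_iff_forall_integral_tendsto.2 fun f => ?_
    have hfm : Measurable f := Measurable.of_discrete
    have hfint {Y : Ω → SwitchMat n} (hY : Measurable Y) : Integrable (fun ω => f (Y ω)) μ :=
      Integrable.of_bound (hfm.comp hY).aestronglyMeasurable ‖f‖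
        (ae_of_all _ fun ω => f.norm_coe_le_norm _)
    have hq := h.isMarkovChain.measurable
    have hD := h.measurable_drivenOrbit_input
    have hB := h.measurable_backwardOrbit_input
    have h1 : Tendsto (fun t => ∫ ω, (f (q t ω)
        - f (drivenOrbit switchStep 0 (fun k => (a k ω, s k ω)) t)) ∂μ) atTop
        (𝓝 (∫ _, (0 : ℝ) ∂μ)) := by
      refine tendsto_integral_of_dominated_convergence (fun _ => ‖f‖ + ‖f‖)
        (fun t => ((hfint (hq t)).sub (hfint (hD t))).aestronglyMeasurable) (integrable_const _)
        (fun t => ae_of_all _ fun ω => (norm_sub_le _ _).trans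
          (add_le_add (f.norm_coe_le_norm _) (f.norm_coe_le_norm _))) ?_
      filter_upwards [h.ae_eventually_eq_drivenOrbit hn hε] with ω hω
      exact tendsto_const_nhds.congr' (hω.mono fun t ht => by simp only [ht, sub_self])
    have h2 : Tendsto (fun t => ∫ ω, f (backwardOrbit switchStep 0 t fun k => (a k ω, s k ω)) ∂μ)
        atTop (𝓝 (∫ ω, f (M ω) ∂μ)) := by
      refine tendsto_integral_of_dominated_convergence (fun _ => ‖f‖)
        (fun t => (hfint (hB t)).aestronglyMeasurable) (integrable_const _)
        (fun t => ae_of_all _ fun ω => f.norm_coe_le_norm _) ?_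
      filter_upwards [hlim] with ω hω
      exact tendsto_const_nhds.congr' (hω.mono fun t ht => by simp only [ht])
    have h3 := h1.add h2
    rw [integral_zero, zero_add] at h3
    have e (t : ℕ) : ∫ ω, (f (q t ω)
        - f (drivenOrbit switchStep 0 (fun k => (a k ω, s k ω)) t)) ∂μ
        + ∫ ω, f (backwardOrbit switchStep 0 t fun k => (a k ω, s k ω)) ∂μ
        = ∫ ω, f (q t ω) ∂μ := by
      have := ((h.identDistrib_orbits t).comp hfm).integral_eq
      simp only [Function.comp_apply] at this
      rw [integral_sub (hfint (hq t)) (hfint (hD t)), this, sub_add_cancel]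
    simp only [e] at h3
    have e1 (t : ℕ) : ∫ x, f x ∂(μ.map (q t)) = ∫ ω, f (q t ω) ∂μ :=
      integral_map (hq t).aemeasurable hfm.aestronglyMeasurable
    have e2 : ∫ x, f x ∂(μ.map M) = ∫ ω, f (M ω) ∂μ :=
      integral_map hM.aemeasurable hfm.aestronglyMeasurable
    simpa only [ProbabilityMeasure.coe_mk, e1, e2] using h3

/-- The queue lengths of a switch under random scheduling converge in distribution, and the mean
total queue length in equilibrium is explicit. -/
theorem exists_stationary (h : IsRandomSwitch μ ε a s q) (hn : n ≠ 0) (hε : 0 < ε) :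
    ∃ π : ProbabilityMeasure (SwitchMat n),
      TendstoInDistribution q atTop id (fun _ => μ) (π : Measure (SwitchMat n)) ∧
      Integrable totalQueue (π : Measure (SwitchMat n)) ∧
      ε * ∫ x, totalQueue x ∂(π : Measure (SwitchMat n))
        = (n : ℝ) / 2 * ∑ i, ∑ j, variance (fun ω => (a 0 ω i j : ℝ)) μ
          + (n : ℝ) * (n - 1) / 2 + n * ε ^ 2 / 2 - n ^ 2 * ε / 2 := by
  obtain ⟨M, hM, hlim⟩ := h.exists_limit_backwardOrbit hn hε
  have hn' : (n : ℝ) ≠ 0 := by exact_mod_cast hn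
  have hconv := h.tendstoInDistribution_limit hn hε hM hlim
  have hmom := h.integrable_limit_and_integral_eq hn hε hM hlim
  have htq : Measurable (totalQueue (n := n)) := Measurable.of_discrete
  obtain ⟨π, hπ⟩ : ∃ π : ProbabilityMeasure (SwitchMat n), (π : Measure (SwitchMat n)) = μ.map M :=
    ⟨⟨μ.map M, Measure.isProbabilityMeasure_map hM.aemeasurable⟩, rfl⟩
  refine ⟨π, ⟨hconv.forall_aemeasurable, aemeasurable_id, ?_⟩, ?_, ?_⟩
  · convert hconv.tendsto using 2
    refine congrArg 𝓝 (Subtype.ext ?_)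
    change (π : Measure (SwitchMat n)).map id = μ.map M
    rw [Measure.map_id, hπ]
  · rw [hπ]
    refine (integrable_map_measure htq.aestronglyMeasurable hM.aemeasurable).2 ?_
    change Integrable (fun ω => ∑ i, ∑ j, (M ω i j : ℝ)) μ
    exact integrable_finsetSum _ fun i _ => integrable_finsetSum _ fun j _ => (hmom i j).1
  · have e : ∫ x, totalQueue x ∂(μ.map M) = ∑ i, ∑ j, ∫ ω, (M ω i j : ℝ) ∂μ := by
      rw [integral_map hM.aemeasurable htq.aestronglyMeasurable]
      simp only [totalQueue]
      rw [integral_finsetSum _ fun i _ => integrable_finsetSum _ fun j _ => (hmom i j).1]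
      exact Finset.sum_congr rfl fun i _ => integral_finsetSum _ fun j _ => (hmom i j).1
    have e' (i j : Fin n) : ε * ∫ ω, (M ω i j : ℝ) ∂μ
        = (n : ℝ) / 2 * variance (fun ω => (a 0 ω i j : ℝ)) μ
          + ((1 - 1 / n) / 2 + ε ^ 2 / (2 * n) - ε / 2) := by
      rw [(hmom i j).2]
      field_simp
      ring
    rw [hπ, e, Finset.mul_sum]
    simp only [Finset.mul_sum, e', Finset.sum_add_distrib, Finset.sum_const, Finset.card_univ,
      Fintype.card_fin, nsmul_eq_mul]
    field_simp
    ring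

end IsRandomSwitch

/-! ### Heavy-traffic limits. -/

theorem mainTheorem7 (n : ℕ) (hn : 1 ≤ n)
    {Ω : ℝ → Type*} [∀ ε, MeasurableSpace (Ω ε)]
    (μ : ∀ ε, Measure (Ω ε)) [∀ ε, IsProbabilityMeasure (μ ε)]
    (a s q : ∀ ε, ℕ → Ω ε → SwitchMat n)
    (hswitch : ∀ ε ∈ Set.Ioo (0 : ℝ) 1, IsRandomSwitch (μ ε) ε (a ε) (s ε) (q ε)) :
    -- the queue lengths form a positive recurrent Markov chain on the states reachable from `0`
    -- (for arbitrary initial queue lengths, from some time on)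
    (∀ ε ∈ Set.Ioo (0 : ℝ) 1,
      IsMarkovChain (μ ε) (q ε) (queueTransition (μ ε) (a ε) (s ε)) ∧
      IsPositiveRecurrentOn (queueTransition (μ ε) (a ε) (s ε))
        (reachableFrom (queueTransition (μ ε) (a ε) (s ε)) 0) ∧
      ∀ᵐ ω ∂(μ ε), ∀ᶠ t in atTop,
        q ε t ω ∈ reachableFrom (queueTransition (μ ε) (a ε) (s ε)) 0) ∧
    -- the queue lengths converge in distribution, to the law `π ε`, which has a finite mean
    ∃ π : ℝ → ProbabilityMeasure (SwitchMat n),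
      (∀ ε ∈ Set.Ioo (0 : ℝ) 1,
        TendstoInDistribution (q ε) atTop id (fun _ => μ ε) (π ε : Measure (SwitchMat n)) ∧
        Integrable totalQueue (π ε : Measure (SwitchMat n))) ∧
      -- the heavy-traffic limit
      (∀ σ : Fin n → Fin n → ℝ,
        (∀ i j, Tendsto (fun ε => variance (fun ω => (a ε 0 ω i j : ℝ)) (μ ε)) (𝓝[>] 0)
          (𝓝 (σ i j ^ 2))) →
        Tendsto (fun ε => ε * ∫ x, totalQueue x ∂(π ε : Measure (SwitchMat n))) (𝓝[>] 0)
          (𝓝 ((n : ℝ) / 2 * frobeniusSq σ + (n : ℝ) * ((n : ℝ) - 1) / 2)) ∧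
        (2 ≤ n →
          ¬ IsMaxWeightLike (fun ε => ∫ x, totalQueue x ∂(π ε : Measure (SwitchMat n))) σ)) ∧
      -- the heavy-traffic limit for uniform Bernoulli traffic
      ((∀ ε ∈ Set.Ioo (0 : ℝ) 1, ∀ t i j, ∀ᵐ ω ∂(μ ε), a ε t ω i j = 0 ∨ a ε t ω i j = 1) →
        Tendsto (fun ε => ε * ∫ x, totalQueue x ∂(π ε : Measure (SwitchMat n))) (𝓝[>] 0)
          (𝓝 ((n : ℝ) * ((n : ℝ) - 1)))) := by
  have hn0 : n ≠ 0 := by omega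
  have hn' : (n : ℝ) ≠ 0 := by exact_mod_cast hn0
  have hex (ε : ℝ) : ∃ π : ProbabilityMeasure (SwitchMat n), ε ∈ Set.Ioo (0 : ℝ) 1 →
      TendstoInDistribution (q ε) atTop id (fun _ => μ ε) (π : Measure (SwitchMat n)) ∧
      Integrable totalQueue (π : Measure (SwitchMat n)) ∧
      ε * ∫ x, totalQueue x ∂(π : Measure (SwitchMat n))
        = (n : ℝ) / 2 * ∑ i, ∑ j, variance (fun ω => (a ε 0 ω i j : ℝ)) (μ ε)
          + (n : ℝ) * (n - 1) / 2 + n * ε ^ 2 / 2 - n ^ 2 * ε / 2 := by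
    by_cases hε : ε ∈ Set.Ioo (0 : ℝ) 1
    · obtain ⟨π, hπ⟩ := (hswitch ε hε).exists_stationary hn0 hε.1
      exact ⟨π, fun _ => hπ⟩
    -- A dummy law: values of `ε` outside `(0, 1)` do not affect the limits at `0` from the right.
    · exact ⟨⟨Measure.dirac 0, inferInstance⟩, fun h => absurd h hε⟩
  choose π hπ using hex
  have hIoo : Set.Ioo (0 : ℝ) 1 ∈ 𝓝[>] (0 : ℝ) := Ioo_mem_nhdsGT one_pos
  have hid : Tendsto (fun ε : ℝ => ε) (𝓝[>] 0) (𝓝 0) := nhdsWithin_le_nhds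
  have hheavy (σ : Fin n → Fin n → ℝ)
      (hσ : ∀ i j, Tendsto (fun ε => variance (fun ω => (a ε 0 ω i j : ℝ)) (μ ε)) (𝓝[>] 0)
        (𝓝 (σ i j ^ 2))) :
      Tendsto (fun ε => ε * ∫ x, totalQueue x ∂(π ε : Measure (SwitchMat n))) (𝓝[>] 0)
        (𝓝 ((n : ℝ) / 2 * frobeniusSq σ + (n : ℝ) * ((n : ℝ) - 1) / 2)) := by
    have h1 : Tendsto (fun ε => (n : ℝ) / 2 * ∑ i, ∑ j,
        variance (fun ω => (a ε 0 ω i j : ℝ)) (μ ε) + (n : ℝ) * (n - 1) / 2 + n * ε ^ 2 / 2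
          - n ^ 2 * ε / 2) (𝓝[>] 0) (𝓝 ((n : ℝ) / 2 * frobeniusSq σ + (n : ℝ) * (n - 1) / 2
          + n * 0 ^ 2 / 2 - n ^ 2 * 0 / 2)) :=
      ((((tendsto_finsetSum _ fun i _ => tendsto_finsetSum _ fun j _ => hσ i j).const_mul
        ((n : ℝ) / 2)).add_const _).add (((hid.pow 2).const_mul _).div_const 2)).sub
        ((hid.const_mul _).div_const 2)
    have e : (n : ℝ) / 2 * frobeniusSq σ + (n : ℝ) * (n - 1) / 2 + n * 0 ^ 2 / 2 - n ^ 2 * 0 / 2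
        = (n : ℝ) / 2 * frobeniusSq σ + (n : ℝ) * ((n : ℝ) - 1) / 2 := by ring
    rw [e] at h1
    refine h1.congr' ?_
    filter_upwards [hIoo] with ε hε
    exact (hπ ε hε).2.2.symm
  refine ⟨fun ε hε => ⟨(hswitch ε hε).isMarkovChain,
    (hswitch ε hε).isPositiveRecurrentOn hn0 hε.1,
    (hswitch ε hε).ae_eventually_mem_reachableFrom hn0 hε.1⟩,
    π, fun ε hε => ⟨(hπ ε hε).1, (hπ ε hε).2.1⟩,
    fun σ hσ => ⟨hheavy σ hσ, fun hn2 hmw => ?_⟩, fun hb => ?_⟩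
  -- For `n ≥ 2`, `1 - 1 / (2 n) ≤ 1 ≤ n / 2`, so the extra term `n (n - 1) / 2 > 0` separates the
  -- two limits even if `σ = 0`.
  · have heq := tendsto_nhds_unique hmw (hheavy σ hσ)
    have hF : 0 ≤ frobeniusSq σ :=
      Finset.sum_nonneg fun i _ => Finset.sum_nonneg fun j _ => sq_nonneg _
    have hn2' : (2 : ℝ) ≤ n := by exact_mod_cast hn2
    have h1 : 0 ≤ 1 / (2 * (n : ℝ)) * frobeniusSq σ := by positivity
    have h2 : 1 * frobeniusSq σ ≤ (n : ℝ) / 2 * frobeniusSq σ :=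
      mul_le_mul_of_nonneg_right (by linarith) hF
    have h3 : 0 < (n : ℝ) * ((n : ℝ) - 1) / 2 := by
      have : (0 : ℝ) < (n : ℝ) - 1 := by linarith
      positivity
    rw [sub_mul] at heq
    linarith
  · have hn1 : (0 : ℝ) ≤ (n : ℝ) - 1 := by
      have : (1 : ℝ) ≤ n := by exact_mod_cast hn
      linarith
    -- `√(n - 1) / n` is the standard deviation of a Bernoulli variable of mean `1 / n`; the `1 - 0`
    -- matches the limit of `(1 - ε) / n` at `ε = 0`.
    have hsq : (√((n : ℝ) - 1) / n) ^ 2 = (1 - 0) / n - ((1 - 0) / (n : ℝ)) ^ 2 := by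
      rw [div_pow, Real.sq_sqrt hn1]
      field_simp
      ring
    have hlim := hheavy (fun _ _ => √((n : ℝ) - 1) / n) fun i j => by
      rw [hsq]
      have h1 : Tendsto (fun ε : ℝ => (1 - ε) / n) (𝓝[>] 0) (𝓝 ((1 - 0) / (n : ℝ))) :=
        (hid.const_sub 1).div_const _
      refine (h1.sub (h1.pow 2)).congr' ?_
      filter_upwards [hIoo] with ε hε
      exact ((hswitch ε hε).variance_arrival_of_bernoulli (hb ε hε 0 i j)).symm
    convert hlim using 2
    simp only [frobeniusSq, hsq, Finset.sum_const, Finset.card_univ, Fintype.card_fin,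
      nsmul_eq_mul]
    field_simp
    ring
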